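/- **Theorem.** Let $\Lambda>0$, $M>0$, $a,m_e\in\mathbb R$, and put $$\Delta_r=(r^2+a^2)\Big(1-\tfrac{\Lambda}{3}r^2\Big)-2Mr,\quad \Delta_\vartheta=1+\tfrac{\Lambda a^2}{3}\cos^2\vartheta,\quad \Xi=1+\tfrac{\Lambda a^2}{3},\quad \Sigma=r^2+a^2\cos^2\vartheta,\quad \widetilde\rho=r+ia\cos\vartheta .$$ Assume that the Kerr–de Sitter black hole is non-extreme, i.e. $\Delta_r$ has four distinct real roots $r_{--}<r_-<r_+<r_c$ ($r_+$ is the event horizon and $r_c$ the cosmological horizon). For $\omega\in\mathbb R$, $k\in\mathbb Z$, $\lambda\in\mathbb C$ write $\widehat k=k+\tfrac12$ and $V(r)=\Xi[\omega(r^2+a^2)+a\widehat k]$. Solutions are understood in the classical sense, with complex values. 1. There is a tortoise coordinate on $(r_+,r_c)$, i.e. a function $u$ with $\frac{du}{dr}=\frac{\Xi(r^2+a^2)}{\Delta_r}$, and every such $u$ maps $(r_+,r_c)$ bijectively onto $\mathbb R$. With $r=r(u)$ its inverse, for all $\omega\in\mathbb R$, $k\in\mathbb Z$, $\lambda\in\mathbb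 C$ the radial Dirac system $$\begin{pmatrix}0&1\\-1&0\end{pmatrix}\frac{d\Omega}{du}+\begin{pmatrix}\frac{m_er\sqrt{\Delta_r}-a\Xi\widehat k}{\Xi(r^2+a^2)}&\frac{\lambda\sqrt{\Delta_r}}{\Xi(r^2+a^2)}\\ \frac{\lambda\sqrt{\Delta_r}}{\Xi(r^2+a^2)}&-\frac{m_er\sqrt{\Delta_r}+a\Xi\widehat k}{\Xi(r^2+a^2)}\end{pmatrix}\Omega=\omega\,\Omega ,\qquad \Omega=(F,G)^T,$$ has no solution on $\mathbb R$ with $\int_{\mathbb R}(|F|^2+|G|^2)\,du<\infty$ other than $\Omega\equiv0$. 2. Equivalently in the radius: for all $\omega\in\mathbb R$, $k\in\mathbb Z$, $\lambda\in\mathbb C$ the radial system $$\sqrt{\Delta_r}\Big(\frac{d}{dr}+\frac{iV}{\Delta_r}\Big)R_--(im_er+\lambda)R_+=0,\qquad (im_er-\lambda)R_-+\sqrt{\Delta_r}\Big(\frac{d}{dr}-\frac{iV}{\Delta_r}\Big)R_+=0$$ has no solution on $(r_+,r_c)$ with $\Xi\int_{r_+}^{r_c}\frac{r^2+a^2}{\Delta_r}(|R_-|^2+|R_+|^2)\,dr<\infty$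 other than $R_-\equiv R_+\equiv0$. 3. The Dirac equation $\mathcal O_D\Psi=0$ of mass $m_e$ on the region $t\in\mathbb R$, $r_+<r<r_c$, $0<\vartheta<\pi$, $\varphi\in\mathbb R$ has no bound states. Here, for $\Psi=(F_1,F_2,G_1,G_2)^T$ ($F_1=-\phi_0$, $F_2=\phi_1$, $G_1=i\chi_{1'}$, $G_2=i\chi_{0'}$ in terms of the spin-frame components of the two-component spinors $\phi_A,\chi_{A'}$), the equation $\mathcal O_D\Psi=0$ reads $$\begin{aligned} -m_eF_1-i\sqrt2(D+\bar\epsilon-\bar\rho)G_1+i\sqrt2(\delta+\bar\pi-\bar\alpha)G_2&=0,\\ -m_eF_2+i\sqrt2(\bar\delta+\bar\beta-\bar\tau)G_1-i\sqrt2(\widetilde\Delta+\bar\mu-\bar\gamma)G_2&=0,\\ -i\sqrt2(\widetilde\Delta+\mu-\gamma)F_1-i\sqrt2(\delta+\beta-\tau)F_2-m_eG_1&=0,\\ -i\sqrt2(\bar\delta+\pi-\alpha)F_1-i\sqrt2(D+\epsilon-\rho)F_2-m_eG_2&=0, \end{aligned}$$ where $D,\widetilde\Delta,\delta,\bar\delta$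 are the derivatives along the Carter null tetrad $l,n,m,\bar m$ of the Kerr–de Sitter metric, whose components with respect to $(t,r,\vartheta,\varphi)$ are $$l,n=\Big(\tfrac{\Xi(r^2+a^2)}{\sqrt{2\Sigma\Delta_r}},\mp\sqrt{\tfrac{\Delta_r}{2\Sigma}},0,\tfrac{\Xi a}{\sqrt{2\Sigma\Delta_r}}\Big),\qquad m=\Big(-\tfrac{i\Xi a\sin\vartheta}{\sqrt{2\Sigma\Delta_\vartheta}},0,-\sqrt{\tfrac{\Delta_\vartheta}{2\Sigma}},-\tfrac{i\Xi}{\sin\vartheta\sqrt{2\Sigma\Delta_\vartheta}}\Big)$$ (upper sign for $l$), and its spin coefficients are $\rho=\mu=\frac1{\widetilde\rho}\sqrt{\frac{\Delta_r}{2\Sigma}}$, $\gamma=\epsilon=\frac12\big(\mu-\frac{\Delta_r'}{2\sqrt{2\Sigma\Delta_r}}\big)$, $\alpha=-\beta=\frac12\big[\frac{\dot\Delta_\vartheta}{2\sqrt{2\Sigma\Delta_\vartheta}}+\sqrt{\frac{\Delta_\vartheta}{2\Sigma}}\big(\cot\vartheta+\frac{ia\sin\vartheta}{\widetilde\rho}\big)\big]$,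 $\tau=-\pi=-\frac{ia\sin\vartheta}{\widetilde\rho}\sqrt{\frac{\Delta_\vartheta}{2\Sigma}}$ (prime and dot are the derivatives in $r$ and $\vartheta$). A bound state is a solution $\Psi\not\equiv0$ of the form $$\Psi=(\Delta_r\Delta_\vartheta)^{-1/4}\,\mathrm{diag}\big(\widetilde\rho^{-1/2},\widetilde\rho^{-1/2},\overline{\widetilde\rho}^{\,-1/2},\overline{\widetilde\rho}^{\,-1/2}\big)\,e^{i\omega t}e^{i(k+\frac12)\varphi}\,\big(R_-S_+,R_+S_-,R_+S_+,R_-S_-\big)^T$$ with $\omega\in\mathbb R$, $k\in\mathbb Z$, functions $R_\pm(r)$ and $S_\pm(\vartheta)$, and $\Xi\int_{r_+}^{r_c}\frac{r^2+a^2}{\Delta_r}(|R_-|^2+|R_+|^2)\,dr<\infty$. -/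

import Mathlib

open scoped ComplexConjugate

namespace KerrDeSitter

noncomputable section

/-! Metric functions of the Kerr-de Sitter space-time with cosmological constant `L`, mass `M`
and angular momentum per unit mass `a`, in Boyer-Lindquist coordinates `(t, r, θ, φ)`. -/

/-- `Δ_r = (r² + a²)(1 - Λ r² / 3) - 2 M r`. -/
def DeltaR (L M a r : ℝ) : ℝ := (r ^ 2 + a ^ 2) * (1 - L / 3 * r ^ 2) - 2 * M * r

/-- `Δ_θ = 1 + (Λ a² / 3) cos² θ`. -/
def DeltaTheta (L a θ : ℝ) : ℝ := 1 + L * a ^ 2 / 3 * Real.cos θ ^ 2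

/-- `Ξ = 1 + Λ a² / 3`. -/
def Xi (L a : ℝ) : ℝ := 1 + L * a ^ 2 / 3

/-- `Σ = r² + a² cos² θ`. -/
def Sig (a r θ : ℝ) : ℝ := r ^ 2 + a ^ 2 * Real.cos θ ^ 2

/-- The non-extreme Kerr-de Sitter black hole: the quartic `Δ_r` has four distinct real roots
`rneg < rin < rp < rc`. The last three are the Cauchy, event and cosmological horizons. -/
structure IsNonExtreme (L M a rneg rin rp rc : ℝ) : Prop where
  cosmological_pos : 0 < L
  mass_pos : 0 < M
  root_neg : DeltaR L M a rneg = 0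
  root_in : DeltaR L M a rin = 0
  root_p : DeltaR L M a rp = 0
  root_c : DeltaR L M a rc = 0
  neg_lt_in : rneg < rin
  in_lt_p : rin < rp
  p_lt_c : rp < rc

/-! ### The radial system -/

/-- The half-integer `k + 1/2` belonging to the azimuthal quantum number `k`. -/
def khat (k : ℤ) : ℝ := (k : ℝ) + 1 / 2

/-- `V(r) = Ξ [ω (r² + a²) + a (k + 1/2)]`. -/
def potV (L a ω : ℝ) (k : ℤ) (r : ℝ) : ℝ := Xi L a * (ω * (r ^ 2 + a ^ 2) + a * khat k)

/-- `(Rm, Rp) = (R₋, R₊)` is a (classical) solution on `(rp, rc)` of the radial system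
`√Δ_r (d/dr + i V/Δ_r) R₋ - (i m r + λ) R₊ = 0`,
`(i m r - λ) R₋ + √Δ_r (d/dr - i V/Δ_r) R₊ = 0`. -/
def IsRadialSolution (L M a rp rc m ω : ℝ) (k : ℤ) (lam : ℂ) (Rm Rp : ℝ → ℂ) : Prop :=
  ∀ r ∈ Set.Ioo rp rc, DifferentiableAt ℝ Rm r ∧ DifferentiableAt ℝ Rp r ∧
    (Real.sqrt (DeltaR L M a r) : ℂ) *
        (deriv Rm r + Complex.I * ((potV L a ω k r / DeltaR L M a r : ℝ) : ℂ) * Rm r)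
      - (Complex.I * m * r + lam) * Rp r = 0 ∧
    (Complex.I * m * r - lam) * Rm r
      + (Real.sqrt (DeltaR L M a r) : ℂ) *
        (deriv Rp r - Complex.I * ((potV L a ω k r / DeltaR L M a r : ℝ) : ℂ) * Rp r) = 0

/-- Square integrability of the radial spinor:
`Ξ ∫_{rp}^{rc} (r² + a²)/Δ_r (|R₋|² + |R₊|²) dr < ∞`. -/
def RadialNormalizable (L M a rp rc : ℝ) (Rm Rp : ℝ → ℂ) : Prop :=
  MeasureTheory.IntegrableOn
    (fun r => Xi L a * (r ^ 2 + a ^ 2) / DeltaR L M a r * (‖Rm r‖ ^ 2 + ‖Rp r‖ ^ 2))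
    (Set.Ioo rp rc)

/-- `u` is a tortoise coordinate on `(rp, rc)`: `du/dr = Ξ (r² + a²)/Δ_r`. -/
def IsTortoise (L M a rp rc : ℝ) (u : ℝ → ℝ) : Prop :=
  ∀ r ∈ Set.Ioo rp rc, HasDerivAt u (Xi L a * (r ^ 2 + a ^ 2) / DeltaR L M a r) r

/-- The matrix `J`. -/
def matJ : Matrix (Fin 2) (Fin 2) ℂ := !![0, 1; -1, 0]

/-- The potential matrix `B` of the Dirac system, as a function of `r`. -/
def matB (L M a m : ℝ) (k : ℤ) (lam : ℂ) (r : ℝ) : Matrix (Fin 2) (Fin 2) ℂ :=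
  !![(((m * r * Real.sqrt (DeltaR L M a r) - a * Xi L a * khat k)
        / (Xi L a * (r ^ 2 + a ^ 2)) : ℝ) : ℂ),
      lam * ((Real.sqrt (DeltaR L M a r) / (Xi L a * (r ^ 2 + a ^ 2)) : ℝ) : ℂ);
     lam * ((Real.sqrt (DeltaR L M a r) / (Xi L a * (r ^ 2 + a ^ 2)) : ℝ) : ℂ),
      ((-(m * r * Real.sqrt (DeltaR L M a r) + a * Xi L a * khat k)
        / (Xi L a * (r ^ 2 + a ^ 2)) : ℝ) : ℂ)]

/-- `W = (F, G)` solves `J dW/du + B(u) W = ω W` on the whole line, the radius being the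
function `rad` of the tortoise coordinate. -/
def IsDiracSystemSolution (L M a m ω : ℝ) (k : ℤ) (lam : ℂ) (rad : ℝ → ℝ)
    (W : ℝ → Fin 2 → ℂ) : Prop :=
  ∀ y : ℝ, DifferentiableAt ℝ W y ∧
    matJ.mulVec (deriv W y) + (matB L M a m k lam (rad y)).mulVec (W y) = (ω : ℂ) • W y

/-- `∫_ℝ (|F|² + |G|²) du < ∞`. -/
def LineSquareIntegrable (W : ℝ → Fin 2 → ℂ) : Prop :=
  MeasureTheory.Integrable (fun y : ℝ => ‖W y 0‖ ^ 2 + ‖W y 1‖ ^ 2)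

/-! ### The Dirac equation in the Carter tetrad

Points are `x = (t, r, θ, φ) : Fin 4 → ℝ`. -/

/-- The contravariant components of the null vector `l`. -/
def vecL (L M a : ℝ) (x : Fin 4 → ℝ) : Fin 4 → ℂ :=
  ![((Xi L a * (x 1 ^ 2 + a ^ 2) / Real.sqrt (2 * Sig a (x 1) (x 2) * DeltaR L M a (x 1)) : ℝ) : ℂ),
    -((Real.sqrt (DeltaR L M a (x 1) / (2 * Sig a (x 1) (x 2))) : ℝ) : ℂ),
    0,
    ((Xi L a * a / Real.sqrt (2 * Sig a (x 1) (x 2) * DeltaR L M a (x 1)) : ℝ) : ℂ)]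

/-- The contravariant components of the null vector `n`. -/
def vecN (L M a : ℝ) (x : Fin 4 → ℝ) : Fin 4 → ℂ :=
  ![((Xi L a * (x 1 ^ 2 + a ^ 2) / Real.sqrt (2 * Sig a (x 1) (x 2) * DeltaR L M a (x 1)) : ℝ) : ℂ),
    ((Real.sqrt (DeltaR L M a (x 1) / (2 * Sig a (x 1) (x 2))) : ℝ) : ℂ),
    0,
    ((Xi L a * a / Real.sqrt (2 * Sig a (x 1) (x 2) * DeltaR L M a (x 1)) : ℝ) : ℂ)]

/-- The contravariant components of the complex null vector `m`. -/
def vecM (L a : ℝ) (x : Fin 4 → ℝ) : Fin 4 → ℂ :=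
  ![-(Complex.I * ((Xi L a * a * Real.sin (x 2)
        / Real.sqrt (2 * Sig a (x 1) (x 2) * DeltaTheta L a (x 2)) : ℝ) : ℂ)),
    0,
    -((Real.sqrt (DeltaTheta L a (x 2) / (2 * Sig a (x 1) (x 2))) : ℝ) : ℂ),
    -(Complex.I * ((Xi L a
        / (Real.sin (x 2) * Real.sqrt (2 * Sig a (x 1) (x 2) * DeltaTheta L a (x 2))) : ℝ) : ℂ))]

/-- The components of the complex conjugate of `m`. -/
def vecMbar (L a : ℝ) (x : Fin 4 → ℝ) : Fin 4 → ℂ := fun μ => conj (vecM L a x μ)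

/-- The directional derivative `X^μ ∂_μ f` at `x` along a complex vector `X`. -/
def dirDeriv (X : Fin 4 → ℂ) (f : (Fin 4 → ℝ) → ℂ) (x : Fin 4 → ℝ) : ℂ :=
  ∑ μ : Fin 4, X μ * fderiv ℝ f x (Pi.single μ 1)

/-- `ρ̃ = r + i a cos θ`. -/
def rhoT (a : ℝ) (x : Fin 4 → ℝ) : ℂ := (x 1 : ℂ) + Complex.I * ((a * Real.cos (x 2) : ℝ) : ℂ)

/-- The spin coefficient `μ`, equal to `ρ`, of the Carter tetrad. -/
def spinMu (L M a : ℝ) (x : Fin 4 → ℝ) : ℂ :=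
  1 / rhoT a x * (Real.sqrt (DeltaR L M a (x 1) / (2 * Sig a (x 1) (x 2))) : ℂ)

/-- The spin coefficient `ε`, equal to `γ`, of the Carter tetrad. -/
def spinEps (L M a : ℝ) (x : Fin 4 → ℝ) : ℂ :=
  1 / 2 * (spinMu L M a x
    - ((deriv (DeltaR L M a) (x 1)
        / (2 * Real.sqrt (2 * Sig a (x 1) (x 2) * DeltaR L M a (x 1))) : ℝ) : ℂ))

/-- The spin coefficient `α`, equal to `-β`, of the Carter tetrad. -/
def spinAlpha (L a : ℝ) (x : Fin 4 → ℝ) : ℂ :=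
  1 / 2 * (((deriv (DeltaTheta L a) (x 2)
        / (2 * Real.sqrt (2 * Sig a (x 1) (x 2) * DeltaTheta L a (x 2))) : ℝ) : ℂ)
    + (Real.sqrt (DeltaTheta L a (x 2) / (2 * Sig a (x 1) (x 2))) : ℂ)
      * (((Real.cos (x 2) / Real.sin (x 2) : ℝ) : ℂ)
        + Complex.I * ((a * Real.sin (x 2) : ℝ) : ℂ) / rhoT a x))

/-- The spin coefficient `τ`, equal to `-π`, of the Carter tetrad. -/
def spinTau (L a : ℝ) (x : Fin 4 → ℝ) : ℂ :=
  -(Complex.I * ((a * Real.sin (x 2) : ℝ) : ℂ) / rhoT a x)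
    * (Real.sqrt (DeltaTheta L a (x 2) / (2 * Sig a (x 1) (x 2))) : ℂ)

/-- The Dirac operator for mass `m`, applied to the spinor field
`Ψ = (F₁, F₂, G₁, G₂)` with `F₁ = -φ₀`, `F₂ = φ₁`, `G₁ = i χ_{1'}`, `G₂ = i χ_{0'}`. Its entries are
`α₊ = -i√2 (D + ε̄ - ρ̄)`, `β₊ = i√2 (δ + π̄ - ᾱ)`, `β₋ = i√2 (δ̄ + β̄ - τ̄)`,
`α₋ = -i√2 (Δ̃ + μ̄ - γ̄)`, and, with a tilde, `α̃₋ = -i√2 (Δ̃ + μ - γ)`, `β̃₊ = i√2 (δ + β - τ)`,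
`β̃₋ = i√2 (δ̄ + π - α)`, `α̃₊ = -i√2 (D + ε - ρ)`, where `D, Δ̃, δ, δ̄` are the derivatives along
`l, n, m, m̄`. -/
def diracOp (L M a m : ℝ) (Ψ : (Fin 4 → ℝ) → Fin 4 → ℂ) (x : Fin 4 → ℝ) : Fin 4 → ℂ :=
  let s : ℂ := Complex.I * (Real.sqrt 2 : ℂ)
  let mu := spinMu L M a x
  let rho := mu
  let eps := spinEps L M a x
  let gam := eps
  let alp := spinAlpha L a x
  let bet := -alp
  let tau := spinTau L a x
  let pai := -tau
  let D : ((Fin 4 → ℝ) → ℂ) → ℂ := fun f => dirDeriv (vecL L M a x) f x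
  let N : ((Fin 4 → ℝ) → ℂ) → ℂ := fun f => dirDeriv (vecN L M a x) f x
  let δ : ((Fin 4 → ℝ) → ℂ) → ℂ := fun f => dirDeriv (vecM L a x) f x
  let δbar : ((Fin 4 → ℝ) → ℂ) → ℂ := fun f => dirDeriv (vecMbar L a x) f x
  let F1 : (Fin 4 → ℝ) → ℂ := fun z => Ψ z 0
  let F2 : (Fin 4 → ℝ) → ℂ := fun z => Ψ z 1
  let G1 : (Fin 4 → ℝ) → ℂ := fun z => Ψ z 2
  let G2 : (Fin 4 → ℝ) → ℂ := fun z => Ψ z 3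
  ![-(m : ℂ) * F1 x + -s * (D G1 + (conj eps - conj rho) * G1 x)
      + s * (δ G2 + (conj pai - conj alp) * G2 x),
    -(m : ℂ) * F2 x + s * (δbar G1 + (conj bet - conj tau) * G1 x)
      + -s * (N G2 + (conj mu - conj gam) * G2 x),
    -s * (N F1 + (mu - gam) * F1 x) - s * (δ F2 + (bet - tau) * F2 x) - (m : ℂ) * G1 x,
    -(s * (δbar F1 + (pai - alp) * F1 x)) + -s * (D F2 + (eps - rho) * F2 x) - (m : ℂ) * G2 x]

/-- The region between the event and the cosmological horizon (off the axis). -/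
def exterior (rp rc : ℝ) : Set (Fin 4 → ℝ) :=
  {x | x 1 ∈ Set.Ioo rp rc ∧ x 2 ∈ Set.Ioo 0 Real.pi}

/-- Classical solutions of the Dirac equation between the horizons. -/
def IsDiracSolution (L M a rp rc m : ℝ) (Ψ : (Fin 4 → ℝ) → Fin 4 → ℂ) : Prop :=
  ∀ x ∈ exterior rp rc, DifferentiableAt ℝ Ψ x ∧ diracOp L M a m Ψ x = 0

/-- The spinor field `Ψ = S e^{iωt} e^{i(k+1/2)φ} (R₋S₊, R₊S₋, R₊S₊, R₋S₋)ᵀ` with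
`S = (Δ_r Δ_θ)^{-1/4} diag(ρ̃^{-1/2}, ρ̃^{-1/2}, conj ρ̃^{-1/2}, conj ρ̃^{-1/2})`. -/
def separatedSpinor (L M a ω : ℝ) (k : ℤ) (Rm Rp Sm Sp : ℝ → ℂ) (x : Fin 4 → ℝ) : Fin 4 → ℂ :=
  let c : ℂ := (((DeltaR L M a (x 1) * DeltaTheta L a (x 2)) ^ (-(1 / 4) : ℝ) : ℝ) : ℂ)
    * Complex.exp (Complex.I * ((ω * x 0 : ℝ) : ℂ))
    * Complex.exp (Complex.I * ((khat k * x 3 : ℝ) : ℂ))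
  let q : ℂ := rhoT a x ^ (-(1 / 2) : ℂ)
  let qbar : ℂ := conj (rhoT a x) ^ (-(1 / 2) : ℂ)
  ![c * q * (Rm (x 1) * Sp (x 2)), c * q * (Rp (x 1) * Sm (x 2)),
    c * qbar * (Rp (x 1) * Sp (x 2)), c * qbar * (Rm (x 1) * Sm (x 2))]

/-- A bound state: a solution of the Dirac equation between the horizons, not identically zero,
which is time-periodic with real energy `ω`, has azimuthal number `k`, is separated by the
Chandrasekhar ansatz, and has a square integrable radial spinor. No boundary or integrability
condition is imposed on the angular functions. -/
def IsBoundState (L M a rp rc m : ℝ) (Ψ : (Fin 4 → ℝ) → Fin 4 → ℂ) : Prop :=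
  IsDiracSolution L M a rp rc m Ψ ∧ (∃ x ∈ exterior rp rc, Ψ x ≠ 0) ∧
    ∃ (ω : ℝ) (k : ℤ) (Rm Rp Sm Sp : ℝ → ℂ), RadialNormalizable L M a rp rc Rm Rp ∧
      ∀ x ∈ exterior rp rc, Ψ x = separatedSpinor L M a ω k Rm Rp Sm Sp x

end

end KerrDeSitter

namespace KerrDeSitter

/-! ### The horizon function between the horizons -/

section Horizons

variable {L M a rneg rin rp rc : ℝ}

/-! The mechanism is that a solution cannot decay at a non-extreme horizon. `Δ_r` has simple zeros
at `rp` and `rc`. In the derivative of `|R₋|² + |R₊|²` the potential `V` drops out, because it only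
rotates the phase of each component. What remains is the coupling `(± i m r + λ)/√Δ_r`, which is
bounded by a multiple of `((r - rp)(rc - r))^(-1/2)` and so is integrable up to both horizons. A
two-sided Grönwall estimate (`exists_comparison_of_abs_deriv_le`) then makes the values of the
squared norm at any two radii comparable, with one constant for the whole interval. A solution that
is nonzero at one radius therefore has norm bounded below throughout, whereas the weight `Ξ (r² +
a²)/Δ_r` has non-integrable simple poles (`exists_weight_bound`). The same argument, pulled back
along the tortoise coordinate, treats the system on the line: a positive constant is not integrable
over `ℝ`. Neither argument uses that `λ` is real.

For bound states, the factor `(Δ_r Δ_θ)^(-1/4) ρ̃^(-1/2)` cancels the spin coefficients, and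
multiplication by `√Σ` splits the mass term into a radial and an angular part. At one fixed angle
where `S₊` or `S₋` is nonzero, the Dirac equation becomes the radial system, with `λ` read off from
the angular functions at that angle. Since the radial result covers every complex `λ`, no angular
eigenvalue problem has to be solved. -/

theorem IsNonExtreme.deltaR_eq (h : IsNonExtreme L M a rneg rin rp rc) (r : ℝ) :
    DeltaR L M a r = L / 3 * ((r - rneg) * (r - rin)) * ((r - rp) * (rc - r)) := by
  obtain ⟨hL, hM, h1, h2, h3, h4, h12, h23, h34⟩ := h
  -- Newton interpolation at the four roots: `e12`, `e23`, `e34` are the negated first divided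
  -- differences of `Δ_r`, then come the second ones and, in `e`, the third. All vanish, so only the
  -- leading term `-L/3` times the product of the four linear factors survives.
  have e12 : L / 3 * (rneg ^ 3 + rneg ^ 2 * rin + rneg * rin ^ 2 + rin ^ 3)
      - (1 - L / 3 * a ^ 2) * (rneg + rin) + 2 * M = 0 := by
    refine (mul_eq_zero.1 ?_).resolve_left (sub_ne_zero.2 h12.ne)
    unfold DeltaR at *
    linear_combination h2 - h1
  have e23 : L / 3 * (rp ^ 3 + rp ^ 2 * rin + rp * rin ^ 2 + rin ^ 3)
      - (1 - L / 3 * a ^ 2) * (rp + rin) + 2 * M = 0 := by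
    refine (mul_eq_zero.1 ?_).resolve_left (sub_ne_zero.2 h23.ne)
    unfold DeltaR at *
    linear_combination h3 - h2
  have e34 : L / 3 * (rp ^ 3 + rp ^ 2 * rc + rp * rc ^ 2 + rc ^ 3)
      - (1 - L / 3 * a ^ 2) * (rp + rc) + 2 * M = 0 := by
    refine (mul_eq_zero.1 ?_).resolve_left (sub_ne_zero.2 h34.ne)
    unfold DeltaR at *
    linear_combination h4 - h3
  have e123 : L / 3 * (rneg ^ 2 + rin ^ 2 + rp ^ 2 + rneg * rin + rin * rp + rneg * rp)
      - (1 - L / 3 * a ^ 2) = 0 := by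
    refine (mul_eq_zero.1 ?_).resolve_left (sub_ne_zero.2 (h12.trans h23).ne)
    linear_combination e12 - e23
  have e234 : L / 3 * (rc ^ 2 + rin ^ 2 + rp ^ 2 + rc * rin + rin * rp + rc * rp)
      - (1 - L / 3 * a ^ 2) = 0 := by
    refine (mul_eq_zero.1 ?_).resolve_left (sub_ne_zero.2 (h23.trans h34).ne)
    linear_combination e23 - e34
  have e : L / 3 * (rneg + rin + rp + rc) = 0 := by
    refine (mul_eq_zero.1 ?_).resolve_left (sub_ne_zero.2 (h12.trans (h23.trans h34)).ne)
    linear_combination e123 - e234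
  unfold DeltaR at *
  linear_combination h1 - (r - rneg) * e12 - (r - rneg) * (r - rin) * e123
    - (r - rneg) * (r - rin) * (r - rp) * e

/-- By Vieta, the roots sum to zero and their third elementary symmetric function is `-6M/L < 0`.
Three non-positive roots would make the latter non-negative. -/
theorem IsNonExtreme.rp_pos (h : IsNonExtreme L M a rneg rin rp rc) : 0 < rp := by
  have hL := h.cosmological_pos
  have hM := h.mass_pos
  have h12 := h.neg_lt_in
  have h23 := h.in_lt_p
  have e1 := h.deltaR_eq 1
  have e2 := h.deltaR_eq (-1)
  have e3 := h.deltaR_eq 2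
  have e4 := h.deltaR_eq (-2)
  unfold DeltaR at e1 e2 e3 e4
  have hs : rneg + rin + rp + rc = 0 := by
    -- The odd part of `Δ_r` at 1 minus half the odd part at 2: the linear term cancels and the
    -- cubic coefficient remains.
    have : L * (rneg + rin + rp + rc) = 0 := by
      linear_combination (1 / 2) * e1 - (1 / 2) * e2 - (1 / 4) * e3 + (1 / 4) * e4
    exact (mul_eq_zero.1 this).resolve_left hL.ne'
  have hrc : rc = -(rneg + rin + rp) := by linarith
  have hq : L / 3 * (rneg * rin * rp + rneg * rin * rc + rneg * rp * rc + rin * rp * rc)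
      = -(2 * M) := by
    linear_combination (1 / 2) * e2 - (1 / 2) * e1 - L / 3 * hs
  by_contra! hp
  have hx : 0 < -rneg := by linarith
  have hy : 0 < -rin := by linarith
  have hz : 0 ≤ -rp := by linarith
  have : 0 ≤ rneg * rin * rp + rneg * rin * rc + rneg * rp * rc + rin * rp * rc := by
    -- With `x, y, z` the negatives of the three smaller roots and `rc = x + y + z`, this is `(x +
    -- y)(y + z)(z + x)`.
    have : rneg * rin * rp + rneg * rin * rc + rneg * rp * rc + rin * rp * rc =
      (-rneg + -rin) * ((-rin) * (-rp) + (-rneg) * (-rin) + (-rneg) * (-rp) + (-rp) * (-rp)) := by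
      rw [hrc]; ring
    rw [this]
    positivity
  nlinarith [mul_nonneg hL.le this]

/-- Both horizons are simple zeros: the cofactor `(r - rneg)(r - rin)` increases on the interval, so
its values at `rp` and `rc` give the two constants. -/
theorem IsNonExtreme.exists_bounds (h : IsNonExtreme L M a rneg rin rp rc) :
    ∃ c C : ℝ, 0 < c ∧ 0 < C ∧ ∀ r ∈ Set.Ioo rp rc,
      c * ((r - rp) * (rc - r)) ≤ DeltaR L M a r ∧
      DeltaR L M a r ≤ C * ((r - rp) * (rc - r)) := by
  have hL := h.cosmological_pos
  have h12 := h.neg_lt_in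
  have h23 := h.in_lt_p
  have h34 := h.p_lt_c
  refine ⟨L / 3 * ((rp - rneg) * (rp - rin)), L / 3 * ((rc - rneg) * (rc - rin)),
    ?_, ?_, fun r hr => ?_⟩
  · have : 0 < rp - rneg := by linarith
    have : 0 < rp - rin := by linarith
    positivity
  · have : 0 < rc - rneg := by linarith
    have : 0 < rc - rin := by linarith
    positivity
  · obtain ⟨hr1, hr2⟩ := hr
    have : 0 ≤ r - rp := by linarith
    have : 0 ≤ rc - r := by linarith
    have : 0 ≤ rp - rneg := by linarith
    have : 0 ≤ rp - rin := by linarith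
    have : 0 ≤ r - rneg := by linarith
    have : 0 ≤ r - rin := by linarith
    have : 0 ≤ rc - rneg := by linarith
    rw [h.deltaR_eq]
    constructor <;> gcongr

theorem IsNonExtreme.deltaR_pos (h : IsNonExtreme L M a rneg rin rp rc) {r : ℝ}
    (hr : r ∈ Set.Ioo rp rc) : 0 < DeltaR L M a r := by
  obtain ⟨c, C, hc, -, hb⟩ := h.exists_bounds
  have h1 : 0 < r - rp := sub_pos.2 hr.1
  have h2 : 0 < rc - r := sub_pos.2 hr.2
  exact lt_of_lt_of_le (by positivity) (hb r hr).1

theorem IsNonExtreme.xi_pos (h : IsNonExtreme L M a rneg rin rp rc) : 0 < Xi L a := by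
  have := h.cosmological_pos
  unfold Xi
  positivity

/-- Partial fractions of `1/((r - rp)(rc - r))`. The simple poles send the tortoise coordinate to
infinity at both ends and exclude normalizable radial solutions. -/
theorem IsNonExtreme.exists_weight_bound (h : IsNonExtreme L M a rneg rin rp rc) :
    ∃ c : ℝ, 0 < c ∧ ∀ r ∈ Set.Ioo rp rc,
      c * (1 / (r - rp) + 1 / (rc - r)) ≤ Xi L a * (r ^ 2 + a ^ 2) / DeltaR L M a r := by
  obtain ⟨_, C, -, hC, hb⟩ := h.exists_bounds
  have hX := h.xi_pos
  have hp := h.rp_pos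
  have hpc : 0 < rc - rp := sub_pos.2 h.p_lt_c
  refine ⟨Xi L a * rp ^ 2 / (C * (rc - rp)), by positivity, fun r hr => ?_⟩
  have h1 : 0 < r - rp := sub_pos.2 hr.1
  have h2 : 0 < rc - r := sub_pos.2 hr.2
  have hΔ := h.deltaR_pos hr
  have : Xi L a * rp ^ 2 / (C * (rc - rp)) * (1 / (r - rp) + 1 / (rc - r)) =
      Xi L a * rp ^ 2 / (C * ((r - rp) * (rc - r))) := by
    field_simp
    ring
  rw [this]
  have h3 : rp ^ 2 ≤ r ^ 2 + a ^ 2 := by nlinarith [sq_nonneg a, hr.1]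
  gcongr
  exact (hb r hr).2

end Horizons

/-! ### A two-sided Grönwall estimate between the horizons -/

/-- The inverse square root singularities have a bounded primitive `g`, so the integrating factors
`exp (± g)` stay between positive constants up to the endpoints. -/
theorem exists_comparison_of_abs_deriv_le {p q C : ℝ} {N N' : ℝ → ℝ} (hC : 0 ≤ C) (hpq : p < q)
    (hN : ∀ r ∈ Set.Ioo p q, HasDerivAt N (N' r) r) (hN0 : ∀ r, 0 ≤ N r)
    (hb : ∀ r ∈ Set.Ioo p q, |N' r| ≤ C / Real.sqrt ((r - p) * (q - r)) * N r) :
    ∃ c : ℝ, 0 < c ∧ ∀ r ∈ Set.Ioo p q, ∀ s ∈ Set.Ioo p q, c * N r ≤ N s := by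
  have hd : 0 < Real.sqrt (q - p) := Real.sqrt_pos.2 (sub_pos.2 hpq)
  set K : ℝ := 2 * C / Real.sqrt (q - p) with hK
  have hK0 : 0 ≤ K := by positivity
  set g : ℝ → ℝ := fun r => K * (Real.sqrt (r - p) - Real.sqrt (q - r)) with hg
  set g' : ℝ → ℝ := fun r => K * (1 / (2 * Real.sqrt (r - p)) + 1 / (2 * Real.sqrt (q - r)))
    with hg'
  have hgd : ∀ r ∈ Set.Ioo p q, HasDerivAt g (g' r) r := by
    intro r hr
    have h1 := ((hasDerivAt_id r).sub_const p).sqrt (sub_pos.2 hr.1).ne'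
    have h2 := ((hasDerivAt_id r).const_sub q).sqrt (sub_pos.2 hr.2).ne'
    refine ((h1.sub h2).const_mul K).congr_deriv ?_
    simp only [hg', id]
    ring
  have hgb : ∀ r ∈ Set.Ioo p q, C / Real.sqrt ((r - p) * (q - r)) ≤ g' r := by
    intro r hr
    have h1 : 0 < r - p := sub_pos.2 hr.1
    have h2 : 0 < q - r := sub_pos.2 hr.2
    have hs1 := Real.sqrt_pos.2 h1
    have hs2 := Real.sqrt_pos.2 h2
    -- Subadditivity of the square root; the normalization of `K` by `√(q - p)` is chosen so that
    -- this gives `C/√((r - p)(q - r)) ≤ g'`.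
    have hle : Real.sqrt (q - p) ≤ Real.sqrt (r - p) + Real.sqrt (q - r) := by
      rw [Real.sqrt_le_left (by positivity)]
      nlinarith [Real.sq_sqrt h1.le, Real.sq_sqrt h2.le, mul_pos hs1 hs2]
    rw [Real.sqrt_mul h1.le]
    have : g' r = C / (Real.sqrt (r - p) * Real.sqrt (q - r)) *
        ((Real.sqrt (r - p) + Real.sqrt (q - r)) / Real.sqrt (q - p)) := by
      simp only [hg', hK]
      field_simp
      ring
    rw [this]
    exact le_mul_of_one_le_right (by positivity) ((one_le_div hd).2 hle)
  have hB : ∀ r ∈ Set.Ioo p q, |g r| ≤ K * Real.sqrt (q - p) := by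
    intro r hr
    rw [hg, abs_mul, abs_of_nonneg hK0]
    gcongr
    have e1 : Real.sqrt (r - p) ≤ Real.sqrt (q - p) := Real.sqrt_le_sqrt (by linarith [hr.2])
    have e2 : Real.sqrt (q - r) ≤ Real.sqrt (q - p) := Real.sqrt_le_sqrt (by linarith [hr.1])
    rw [abs_le]
    constructor <;> linarith [Real.sqrt_nonneg (r - p), Real.sqrt_nonneg (q - r)]
  set B := K * Real.sqrt (q - p)
  have hmono : MonotoneOn (fun r => N r * Real.exp (g r)) (Set.Ioo p q) := by
    have hD : ∀ r ∈ Set.Ioo p q, HasDerivAt (fun r => N r * Real.exp (g r))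
        (N' r * Real.exp (g r) + N r * (Real.exp (g r) * g' r)) r :=
      fun r hr => (hN r hr).mul (hgd r hr).exp
    refine monotoneOn_of_deriv_nonneg (convex_Ioo p q)
      (fun r hr => (hD r hr).continuousAt.continuousWithinAt) ?_ ?_
    · rw [interior_Ioo]
      exact fun r hr => (hD r hr).differentiableAt.differentiableWithinAt
    · rw [interior_Ioo]
      intro r hr
      rw [(hD r hr).deriv]
      have h1 := neg_le_of_abs_le (hb r hr)
      have h2 := mul_le_mul_of_nonneg_right (hgb r hr) (hN0 r)
      have h3 : 0 ≤ N' r + g' r * N r := by linarith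
      nlinarith [mul_nonneg h3 (Real.exp_pos (g r)).le]
  have hanti : AntitoneOn (fun r => N r * Real.exp (-g r)) (Set.Ioo p q) := by
    have hD : ∀ r ∈ Set.Ioo p q, HasDerivAt (fun r => N r * Real.exp (-g r))
        (N' r * Real.exp (-g r) + N r * (Real.exp (-g r) * -g' r)) r :=
      fun r hr => (hN r hr).mul (hgd r hr).neg.exp
    refine antitoneOn_of_deriv_nonpos (convex_Ioo p q)
      (fun r hr => (hD r hr).continuousAt.continuousWithinAt) ?_ ?_
    · rw [interior_Ioo]
      exact fun r hr => (hD r hr).differentiableAt.differentiableWithinAt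
    · rw [interior_Ioo]
      intro r hr
      rw [(hD r hr).deriv]
      have h1 := le_of_abs_le (hb r hr)
      have h2 := mul_le_mul_of_nonneg_right (hgb r hr) (hN0 r)
      have h3 : 0 ≤ g' r * N r - N' r := by linarith
      nlinarith [mul_nonneg h3 (Real.exp_pos (-g r)).le]
  -- Two values of `g` differ by at most `2 * B`.
  refine ⟨Real.exp (-(2 * B)), Real.exp_pos _, fun r hr s hs => ?_⟩
  have hr' := abs_le.1 (hB r hr)
  have hs' := abs_le.1 (hB s hs)
  rcases le_total r s with hrs | hrs
  · have h1 : N r * Real.exp (g r) ≤ N s * Real.exp (g s) := hmono hr hs hrs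
    calc Real.exp (-(2 * B)) * N r ≤ Real.exp (g r - g s) * N r := by
          gcongr
          · exact hN0 r
          · linarith
      _ = N r * Real.exp (g r) * Real.exp (-g s) := by
          rw [sub_eq_add_neg, Real.exp_add]; ring
      _ ≤ N s * Real.exp (g s) * Real.exp (-g s) := by gcongr
      _ = N s := by rw [mul_assoc, ← Real.exp_add]; simp
  · have h1 : N r * Real.exp (-g r) ≤ N s * Real.exp (-g s) := hanti hs hr hrs
    calc Real.exp (-(2 * B)) * N r ≤ Real.exp (-g r + g s) * N r := by
          gcongr
          · exact hN0 r
          · linarith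
      _ = N r * Real.exp (-g r) * Real.exp (g s) := by
          rw [Real.exp_add]; ring
      _ ≤ N s * Real.exp (-g s) * Real.exp (g s) := by gcongr
      _ = N s := by rw [mul_assoc, ← Real.exp_add]; simp

/-! ### The tortoise coordinate -/

section Tortoise

variable {L M a rneg rin rp rc : ℝ}

theorem IsNonExtreme.exists_isTortoise (h : IsNonExtreme L M a rneg rin rp rc) :
    ∃ u : ℝ → ℝ, IsTortoise L M a rp rc u := by
  set f : ℝ → ℝ := fun r => Xi L a * (r ^ 2 + a ^ 2) / DeltaR L M a r with hf
  have hc : ContinuousOn f (Set.Ioo rp rc) := by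
    refine ContinuousOn.div (by fun_prop) ?_ fun r hr => (h.deltaR_pos hr).ne'
    unfold DeltaR
    fun_prop
  have hpc := h.p_lt_c
  refine ⟨fun r => ∫ x in ((rp + rc) / 2)..r, f x, fun r hr => ?_⟩
  have hm : (rp + rc) / 2 ∈ Set.Ioo rp rc := ⟨by linarith, by linarith⟩
  have hsub : Set.uIcc ((rp + rc) / 2) r ⊆ Set.Ioo rp rc :=
    Set.OrdConnected.uIcc_subset Set.ordConnected_Ioo hm hr
  exact intervalIntegral.integral_hasDerivAt_right (hc.mono hsub).intervalIntegrable
    (hc.stronglyMeasurableAtFilter isOpen_Ioo r hr) (hc.continuousAt (isOpen_Ioo.mem_nhds hr))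

/-- Injectivity is positivity of the derivative. Surjectivity follows by comparison with `c (log (r
- rp) - log (rc - r))`, which forces `u` to `-∞` at `rp` and to `+∞` at `rc`; the intermediate value
theorem does the rest. -/
theorem IsTortoise.bijOn (h : IsNonExtreme L M a rneg rin rp rc) {u : ℝ → ℝ}
    (hu : IsTortoise L M a rp rc u) : Set.BijOn u (Set.Ioo rp rc) Set.univ := by
  obtain ⟨c, hc, hb⟩ := h.exists_weight_bound
  have hpc := h.p_lt_c
  have hcont : ContinuousOn u (Set.Ioo rp rc) :=
    fun r hr => (hu r hr).continuousAt.continuousWithinAt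
  refine ⟨Set.mapsTo_univ _ _, StrictMonoOn.injOn ?_, ?_⟩
  · refine strictMonoOn_of_deriv_pos (convex_Ioo rp rc) hcont ?_
    rw [interior_Ioo]
    intro r hr
    rw [(hu r hr).deriv]
    have h1 : 0 < r - rp := sub_pos.2 hr.1
    have h2 : 0 < rc - r := sub_pos.2 hr.2
    exact lt_of_lt_of_le (by positivity) (hb r hr)
  have hmono : MonotoneOn (fun r => u r - c * (Real.log (r - rp) - Real.log (rc - r)))
      (Set.Ioo rp rc) := by
    have hD : ∀ r ∈ Set.Ioo rp rc,
        HasDerivAt (fun r => u r - c * (Real.log (r - rp) - Real.log (rc - r)))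
        (Xi L a * (r ^ 2 + a ^ 2) / DeltaR L M a r - c * (1 / (r - rp) + 1 / (rc - r))) r := by
      intro r hr
      have h1 := ((hasDerivAt_id r).sub_const rp).log (sub_pos.2 hr.1).ne'
      have h2 := ((hasDerivAt_id r).const_sub rc).log (sub_pos.2 hr.2).ne'
      refine ((hu r hr).sub ((h1.sub h2).const_mul c)).congr_deriv ?_
      simp only [id]
      ring
    refine monotoneOn_of_deriv_nonneg (convex_Ioo rp rc)
      (fun r hr => (hD r hr).continuousAt.continuousWithinAt) ?_ ?_
    · rw [interior_Ioo]
      exact fun r hr => (hD r hr).differentiableAt.differentiableWithinAt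
    · rw [interior_Ioo]
      intro r hr
      rw [(hD r hr).deriv]
      exact sub_nonneg.2 (hb r hr)
  set r₀ := (rp + rc) / 2 with hr₀
  have hm : r₀ ∈ Set.Ioo rp rc := ⟨by linarith, by linarith⟩
  set k := u r₀ - c * (Real.log (r₀ - rp) - Real.log (rc - r₀)) with hk
  have hup : ∀ r ∈ Set.Ioo rp rc, r₀ ≤ r →
      k + c * (Real.log (r₀ - rp) - Real.log (rc - r)) ≤ u r := by
    intro r hr hle
    have h1 := hmono hm hr hle
    have h2 : Real.log (r₀ - rp) ≤ Real.log (r - rp) :=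
      Real.log_le_log (sub_pos.2 hm.1) (by linarith)
    have h3 := mul_le_mul_of_nonneg_left h2 hc.le
    simp only [← hk] at h1
    linarith
  have hlow : ∀ r ∈ Set.Ioo rp rc, r ≤ r₀ →
      u r ≤ k + c * (Real.log (r - rp) - Real.log (rc - r₀)) := by
    intro r hr hle
    have h1 := hmono hr hm hle
    have h2 : Real.log (rc - r₀) ≤ Real.log (rc - r) :=
      Real.log_le_log (sub_pos.2 hm.2) (by linarith)
    have h3 := mul_le_mul_of_nonneg_left h2 hc.le
    simp only [← hk] at h1
    linarith
  intro y _
  have hlog : ∀ T δ : ℝ, 0 < δ → ∃ ε : ℝ, 0 < ε ∧ ε < δ ∧ Real.log ε ≤ T := by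
    intro T δ hδ
    refine ⟨min (δ / 2) (Real.exp T), by positivity, ?_, ?_⟩
    · exact lt_of_le_of_lt (min_le_left _ _) (by linarith)
    · exact (Real.log_le_log (by positivity) (min_le_right _ _)).trans_eq (Real.log_exp T)
  -- The thresholds solve the bounds `hlow` and `hup` for the target value `y`.
  obtain ⟨ε₁, h1, h1', h1''⟩ :=
    hlog (Real.log (rc - r₀) + (y - k) / c) (r₀ - rp) (sub_pos.2 hm.1)
  obtain ⟨ε₂, h2, h2', h2''⟩ :=
    hlog (Real.log (r₀ - rp) - (y - k) / c) (rc - r₀) (sub_pos.2 hm.2)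
  have hA : rp + ε₁ ∈ Set.Ioo rp rc := ⟨by linarith, by linarith⟩
  have hB : rc - ε₂ ∈ Set.Ioo rp rc := ⟨by linarith, by linarith⟩
  have hyA : u (rp + ε₁) ≤ y := by
    refine (hlow _ hA (by linarith)).trans ?_
    have : c * (Real.log (rp + ε₁ - rp) - Real.log (rc - r₀)) ≤ c * ((y - k) / c) := by
      gcongr
      rw [add_sub_cancel_left]
      linarith
    rw [mul_div_cancel₀ _ hc.ne'] at this
    linarith
  have hyB : y ≤ u (rc - ε₂) := by
    refine le_trans ?_ (hup _ hB (by linarith))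
    have : c * ((y - k) / c) ≤ c * (Real.log (r₀ - rp) - Real.log (rc - (rc - ε₂))) := by
      gcongr
      rw [sub_sub_cancel]
      linarith
    rw [mul_div_cancel₀ _ hc.ne'] at this
    linarith
  exact isPreconnected_Ioo.intermediate_value hA hB hcont ⟨hyA, hyB⟩

end Tortoise

/-! ### The radial systems -/

theorem hasDerivAt_norm_sq_comp {f : ℝ → ℂ} {f' : ℂ} {r : ℝ} (hf : HasDerivAt f f' r) :
    HasDerivAt (fun x => ‖f x‖ ^ 2) (2 * (conj (f r) * f').re) r := by
  refine hf.norm_sq.congr_deriv ?_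
  rw [Complex.inner]
  ring_nf

theorem abs_re_conj_mul_mul_le (z w c : ℂ) :
    |(conj z * (c * w)).re| ≤ ‖c‖ / 2 * (‖z‖ ^ 2 + ‖w‖ ^ 2) := by
  refine (Complex.abs_re_le_norm _).trans ?_
  rw [norm_mul, norm_mul, RCLike.norm_conj]
  nlinarith [norm_nonneg c, mul_nonneg (norm_nonneg c) (sq_nonneg (‖z‖ - ‖w‖))]

section Radial

variable {L M a rneg rin rp rc : ℝ}

theorem IsRadialSolution.eq_zero (h : IsNonExtreme L M a rneg rin rp rc) {m ω : ℝ} {k : ℤ}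
    {lam : ℂ} {Rm Rp : ℝ → ℂ} (hR : IsRadialSolution L M a rp rc m ω k lam Rm Rp)
    (hI : RadialNormalizable L M a rp rc Rm Rp) :
    ∀ r ∈ Set.Ioo rp rc, Rm r = 0 ∧ Rp r = 0 := by
  obtain ⟨κ, _, hκ, -, hΔ⟩ := h.exists_bounds
  obtain ⟨c, hc, hw⟩ := h.exists_weight_bound
  have hrp := h.rp_pos
  have hpc := h.p_lt_c
  set B : ℝ := |m| * rc + ‖lam‖ with hB
  have hB0 : 0 ≤ B := by have := hrp.trans hpc; positivity
  set N : ℝ → ℝ := fun r => ‖Rm r‖ ^ 2 + ‖Rp r‖ ^ 2 with hN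
  set N' : ℝ → ℝ := fun r => 2 * (conj (Rm r) * deriv Rm r).re + 2 * (conj (Rp r) * deriv Rp r).re
    with hN'
  have hN0 : ∀ r, 0 ≤ N r := fun r => by positivity
  have key : ∀ r ∈ Set.Ioo rp rc,
      |N' r| ≤ (2 * B / Real.sqrt κ) / Real.sqrt ((r - rp) * (rc - r)) * N r := by
    intro r hr
    obtain ⟨-, -, e1, e2⟩ := hR r hr
    have hpos := h.deltaR_pos hr
    have h1 : 0 < r - rp := sub_pos.2 hr.1
    have h2 : 0 < rc - r := sub_pos.2 hr.2
    set d := Real.sqrt (DeltaR L M a r) with hd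
    have hd0 : 0 < d := Real.sqrt_pos.2 hpos
    have hdc : (d : ℂ) ≠ 0 := by exact_mod_cast hd0.ne'
    set v : ℝ := potV L a ω k r / DeltaR L M a r
    have f1 : deriv Rm r = -(Complex.I * v * Rm r) + (Complex.I * m * r + lam) / d * Rp r := by
      field_simp
      linear_combination e1
    have f2 : deriv Rp r = Complex.I * v * Rp r + -(Complex.I * m * r - lam) / d * Rm r := by
      field_simp
      linear_combination e2
    have g : N' r = 2 * (conj (Rm r) * ((Complex.I * m * r + lam) / d * Rp r)).re
        + 2 * (conj (Rp r) * (-(Complex.I * m * r - lam) / d * Rm r)).re := by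
      simp only [hN']
      rw [f1, f2]
      -- The potential term is an imaginary multiple of `|z|²`, so `ω` and `k` leave the estimate.
      have q1 : ∀ z : ℂ, (conj z * (Complex.I * v * z)).re = 0 := by
        intro z
        simp
        ring
      rw [mul_add, mul_add, Complex.add_re, Complex.add_re, mul_neg, Complex.neg_re, q1, q1]
      ring
    have nb : ‖Complex.I * m * r‖ ≤ |m| * rc := by
      rw [norm_mul, norm_mul, Complex.norm_I, one_mul, Complex.norm_real, Complex.norm_real,
        Real.norm_eq_abs, Real.norm_eq_abs, abs_of_pos (hrp.trans hr.1)]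
      gcongr
      exact hr.2.le
    have b1 : ‖(Complex.I * m * r + lam) / d‖ ≤ B / d := by
      rw [norm_div, Complex.norm_real, Real.norm_eq_abs, abs_of_pos hd0]
      gcongr
      exact (norm_add_le _ _).trans (add_le_add_left nb _)
    have b2 : ‖-(Complex.I * m * r - lam) / d‖ ≤ B / d := by
      rw [norm_div, norm_neg, Complex.norm_real, Real.norm_eq_abs, abs_of_pos hd0]
      gcongr
      exact (norm_sub_le _ _).trans (add_le_add_left nb _)
    have hdκ : Real.sqrt κ * Real.sqrt ((r - rp) * (rc - r)) ≤ d := by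
      rw [← Real.sqrt_mul hκ.le]
      exact Real.sqrt_le_sqrt (hΔ r hr).1
    have hs : 0 < Real.sqrt ((r - rp) * (rc - r)) := Real.sqrt_pos.2 (by positivity)
    have hk : 0 < Real.sqrt κ := Real.sqrt_pos.2 hκ
    calc |N' r| ≤ 2 * (B / d) * N r := by
          rw [g]
          refine (abs_add_le _ _).trans ?_
          rw [abs_mul, abs_mul, abs_two]
          have t1 := abs_re_conj_mul_mul_le (Rm r) (Rp r) ((Complex.I * m * r + lam) / d)
          have t2 := abs_re_conj_mul_mul_le (Rp r) (Rm r) (-(Complex.I * m * r - lam) / d)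
          have t3 := mul_le_mul_of_nonneg_right b1 (hN0 r)
          have t4 := mul_le_mul_of_nonneg_right b2 (hN0 r)
          simp only [hN] at t3 t4 ⊢
          linarith
      _ ≤ _ := by
          refine mul_le_mul_of_nonneg_right ?_ (hN0 r)
          rw [div_div, mul_div_assoc']
          gcongr
  obtain ⟨η, hη, hcmp⟩ := exists_comparison_of_abs_deriv_le (N := N) (N' := N')
    (C := 2 * B / Real.sqrt κ) (by positivity) hpc
    (fun r hr => (hasDerivAt_norm_sq_comp (hR r hr).1.hasDerivAt).add
      (hasDerivAt_norm_sq_comp (hR r hr).2.1.hasDerivAt)) hN0 key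
  intro r hr
  suffices hz : N r = 0 by
    simp only [hN] at hz
    constructor
    · have : ‖Rm r‖ ^ 2 = 0 := by nlinarith [sq_nonneg ‖Rm r‖, sq_nonneg ‖Rp r‖]
      simpa using this
    · have : ‖Rp r‖ ^ 2 = 0 := by nlinarith [sq_nonneg ‖Rm r‖, sq_nonneg ‖Rp r‖]
      simpa using this
  by_contra hne
  have hNr : 0 < N r := lt_of_le_of_ne (hN0 r) (Ne.symm hne)
  -- Normalizability together with the lower bound on `N` would make the simple pole at `rc`
  -- integrable.
  have hint : MeasureTheory.IntegrableOn (fun s => (s - rc)⁻¹) (Set.Ioo rp rc) := by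
    have hI' := MeasureTheory.Integrable.const_mul hI (1 / (c * (η * N r)))
    refine MeasureTheory.Integrable.mono' hI'
      (by fun_prop) ?_
    refine (MeasureTheory.ae_restrict_iff' measurableSet_Ioo).2 (.of_forall fun s hs => ?_)
    have h1 : 0 < s - rp := sub_pos.2 hs.1
    have h2 : 0 < rc - s := sub_pos.2 hs.2
    have h3 : c * (1 / (rc - s)) ≤ Xi L a * (s ^ 2 + a ^ 2) / DeltaR L M a s := by
      refine le_trans ?_ (hw s hs)
      gcongr
      have : 0 < 1 / (s - rp) := by positivity
      linarith
    have h4 := hcmp r hr s hs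
    have h5 : c * (1 / (rc - s)) * (η * N r) ≤
        Xi L a * (s ^ 2 + a ^ 2) / DeltaR L M a s * N s :=
      mul_le_mul h3 h4 (by positivity) (le_trans (by positivity) h3)
    rw [norm_inv, Real.norm_eq_abs, abs_sub_comm, abs_of_pos h2, div_mul_eq_mul_div, one_mul,
      le_div_iff₀ (by positivity)]
    refine le_of_eq_of_le ?_ h5
    field_simp
  have := (intervalIntegrable_iff_integrableOn_Ioo_of_le hpc.le).2 hint
  rw [intervalIntegrable_sub_inv_iff] at this
  rcases this with h' | h'
  · exact hpc.ne h'
  · exact h' Set.right_mem_uIcc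

/-- The Grönwall estimate is applied to `Q ∘ u` on the radial interval, where the end behaviour of
the coefficients is explicit, and the resulting lower bound is carried back to the line. -/
theorem IsDiracSystemSolution.eq_zero (h : IsNonExtreme L M a rneg rin rp rc) {m ω : ℝ} {k : ℤ}
    {lam : ℂ} {u rad : ℝ → ℝ} (hu : IsTortoise L M a rp rc u)
    (hrad : ∀ y : ℝ, rad y ∈ Set.Ioo rp rc ∧ u (rad y) = y) {W : ℝ → Fin 2 → ℂ}
    (hW : IsDiracSystemSolution L M a m ω k lam rad W) (hI : LineSquareIntegrable W) (y : ℝ) :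
    W y = 0 := by
  obtain ⟨κ, _, hκ, -, hΔ⟩ := h.exists_bounds
  have hrp := h.rp_pos
  have hpc := h.p_lt_c
  have hX := h.xi_pos
  have hinj := (hu.bijOn h).injOn
  -- `rad` is given as a right inverse only; injectivity of `u` makes it two-sided.
  have hru : ∀ r ∈ Set.Ioo rp rc, rad (u r) = r := fun r hr =>
    hinj (hrad (u r)).1 hr (hrad (u r)).2
  set B : ℝ := |m| * rc + ‖lam‖ with hB
  have hB0 : 0 ≤ B := by have := hrp.trans hpc; positivity
  set Q : ℝ → ℝ := fun y => ‖W y 0‖ ^ 2 + ‖W y 1‖ ^ 2 with hQ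
  have hQ0 : ∀ y, 0 ≤ Q y := fun r => by positivity
  set Q' : ℝ → ℝ := fun y =>
    2 * (conj (W y 0) * deriv W y 0).re + 2 * (conj (W y 1) * deriv W y 1).re with hQ'
  have hQd : ∀ y, HasDerivAt Q (Q' y) y := fun y => by
    have := hasDerivAt_pi.1 (hW y).1.hasDerivAt
    exact (hasDerivAt_norm_sq_comp (this 0)).add (hasDerivAt_norm_sq_comp (this 1))
  have hQb : ∀ r ∈ Set.Ioo rp rc, |Q' (u r)| ≤
      2 * B * (Real.sqrt (DeltaR L M a r) / (Xi L a * (r ^ 2 + a ^ 2))) * Q (u r) := by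
    intro r hr
    have hr0 : 0 < r := hrp.trans hr.1
    have e := (hW (u r)).2
    rw [hru r hr] at e
    have e0 := congrFun e 0
    have e1 := congrFun e 1
    simp only [matJ, matB, Pi.add_apply, Matrix.mulVec, dotProduct, Fin.sum_univ_two,
      Matrix.of_apply, Matrix.cons_val_zero, Matrix.cons_val_one, Pi.smul_apply, smul_eq_mul,
      zero_mul, one_mul, zero_add, add_zero, neg_mul, Matrix.cons_val', Matrix.cons_val_fin_one]
      at e0 e1
    set w : ℝ := Real.sqrt (DeltaR L M a r) / (Xi L a * (r ^ 2 + a ^ 2)) with hw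
    have hw0 : 0 ≤ w := by positivity
    set x : ℝ := m * r * w with hx
    set s : ℝ := a * Xi L a * khat k / (Xi L a * (r ^ 2 + a ^ 2)) with hs
    have t1 : (m * r * Real.sqrt (DeltaR L M a r) - a * Xi L a * khat k)
        / (Xi L a * (r ^ 2 + a ^ 2)) = x - s := by
      rw [hx, hs, hw]; ring
    have t2 : -(m * r * Real.sqrt (DeltaR L M a r) + a * Xi L a * khat k)
        / (Xi L a * (r ^ 2 + a ^ 2)) = -x - s := by
      rw [hx, hs, hw]; ring
    rw [t1] at e0
    rw [t2] at e1
    set F := W (u r) 0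
    set G := W (u r) 1
    have f0 : deriv W (u r) 0 = lam * w * F + ((-x - s - ω : ℝ) : ℂ) * G := by
      push_cast at e1 ⊢
      linear_combination -e1
    have f1 : deriv W (u r) 1 = ((ω - x + s : ℝ) : ℂ) * F + (-(lam * w)) * G := by
      push_cast at e0 ⊢
      linear_combination e0
    -- The terms in `ω` and `s` couple `F` and `G` antisymmetrically and cancel in the real part;
    -- the mass term `x` is symmetric and doubles.
    have g : Q' (u r) = 2 * (conj F * ((lam * w) * F)).re + 2 * (conj G * (-(lam * w) * G)).re
        + 4 * (conj F * (((-x : ℝ) : ℂ) * G)).re := by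
      simp only [hQ']
      rw [f0, f1]
      simp
      ring
    have n1 : ‖lam * (w : ℂ)‖ = ‖lam‖ * w := by
      rw [norm_mul, Complex.norm_real, Real.norm_eq_abs, abs_of_nonneg hw0]
    have n2 : ‖((-x : ℝ) : ℂ)‖ ≤ |m| * rc * w := by
      rw [Complex.norm_real, Real.norm_eq_abs, abs_neg, hx, abs_mul, abs_mul, abs_of_pos hr0,
        abs_of_nonneg hw0]
      gcongr
      exact hr.2.le
    have s1 := abs_re_conj_mul_mul_le F F (lam * w)
    have s2 := abs_re_conj_mul_mul_le G G (-(lam * w))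
    have s3 := abs_re_conj_mul_mul_le F G ((-x : ℝ) : ℂ)
    rw [norm_neg] at s2
    rw [n1] at s1 s2
    have s4 := mul_le_mul_of_nonneg_right n2 (hQ0 (u r))
    have hQr : Q (u r) = ‖F‖ ^ 2 + ‖G‖ ^ 2 := rfl
    rw [g]
    refine (abs_add_le _ _).trans ((add_le_add_left (abs_add_le _ _) _).trans ?_)
    rw [abs_mul, abs_mul, abs_mul, abs_two, abs_of_pos (four_pos : (0 : ℝ) < 4)]
    rw [hQr] at s4 ⊢
    rw [hB]
    nlinarith
  obtain ⟨η, hη, hcmp⟩ := exists_comparison_of_abs_deriv_le (N := fun r => Q (u r))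
    (N' := fun r => Q' (u r) * (Xi L a * (r ^ 2 + a ^ 2) / DeltaR L M a r))
    (C := 2 * B / Real.sqrt κ) (by positivity) hpc
    (fun r hr => (hQd (u r)).comp r (hu r hr)) (fun r => hQ0 _) (by
      intro r hr
      have hpos := h.deltaR_pos hr
      have hr0 : 0 < r := hrp.trans hr.1
      have h1 : 0 < r - rp := sub_pos.2 hr.1
      have h2 : 0 < rc - r := sub_pos.2 hr.2
      have hdκ : Real.sqrt κ * Real.sqrt ((r - rp) * (rc - r)) ≤ Real.sqrt (DeltaR L M a r) := by
        rw [← Real.sqrt_mul hκ.le]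
        exact Real.sqrt_le_sqrt (hΔ r hr).1
      have hs : 0 < Real.sqrt ((r - rp) * (rc - r)) := Real.sqrt_pos.2 (by positivity)
      have hk : 0 < Real.sqrt κ := Real.sqrt_pos.2 hκ
      have hd : 0 < Real.sqrt (DeltaR L M a r) := Real.sqrt_pos.2 hpos
      have hd2 := Real.sq_sqrt hpos.le
      rw [abs_mul, abs_of_pos (a := _ / _) (by positivity)]
      calc _ ≤ 2 * B * (Real.sqrt (DeltaR L M a r) / (Xi L a * (r ^ 2 + a ^ 2))) * Q (u r)
              * (Xi L a * (r ^ 2 + a ^ 2) / DeltaR L M a r) := by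
            gcongr
            exact hQb r hr
        -- The factor `Ξ (r² + a²)` of `du/dr` cancels against the coefficients, leaving the same
        -- `1/√Δ_r` as in the radial system.
        _ = 2 * B / Real.sqrt (DeltaR L M a r) * Q (u r) := by
            nth_rewrite 2 [← hd2]
            field_simp
        _ ≤ _ := by
            refine mul_le_mul_of_nonneg_right ?_ (hQ0 _)
            rw [div_div]
            gcongr)
  suffices hz : Q y = 0 by
    simp only [hQ] at hz
    have z0 : ‖W y 0‖ ^ 2 = 0 := by nlinarith [sq_nonneg ‖W y 0‖, sq_nonneg ‖W y 1‖]
    have z1 : ‖W y 1‖ ^ 2 = 0 := by nlinarith [sq_nonneg ‖W y 0‖, sq_nonneg ‖W y 1‖]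
    funext i
    fin_cases i
    · simpa using z0
    · simpa using z1
  by_contra hne
  have hQy : 0 < Q y := lt_of_le_of_ne (hQ0 y) (Ne.symm hne)
  have hconst : MeasureTheory.Integrable (fun _ : ℝ => η * Q y) := by
    refine MeasureTheory.Integrable.mono' hI (by fun_prop) (.of_forall fun z => ?_)
    rw [Real.norm_eq_abs, abs_of_pos (by positivity)]
    have := hcmp _ (hrad y).1 _ (hrad z).1
    simpa only [(hrad y).2, (hrad z).2] using this
  rw [MeasureTheory.integrable_const_iff] at hconst
  rcases hconst with h' | h'
  · exact (by positivity : η * Q y ≠ 0) h'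
  · have := h'.measure_univ_lt_top
    simp at this

end Radial

/-! ### Separated spinors -/

/-- The common factor `(Δ_r Δ_θ)^{-1/4} e^{iωt} e^{i(k+1/2)φ} ρ̃^{-1/2}` of a separated spinor; for
`-a` in place of `a` it carries the conjugate of `ρ̃`. -/
noncomputable def amplitude (L M a ω : ℝ) (k : ℤ) (x : Fin 4 → ℝ) : ℂ :=
  (((DeltaR L M a (x 1) * DeltaTheta L a (x 2)) ^ (-(1 / 4) : ℝ) : ℝ) : ℂ)
    * Complex.exp (Complex.I * ((ω * x 0 : ℝ) : ℂ))
    * Complex.exp (Complex.I * ((khat k * x 3 : ℝ) : ℂ)) * rhoT a x ^ (-(1 / 2) : ℂ)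

/-! ### Complex conjugation as the reflection of `a` to `-a` -/

section Parity

variable (L M a ω : ℝ) (k : ℤ) (x : Fin 4 → ℝ)

theorem deltaR_neg : DeltaR L M (-a) = DeltaR L M a := by
  funext r; simp [DeltaR]

theorem deltaTheta_neg : DeltaTheta L (-a) = DeltaTheta L a := by
  funext θ; simp [DeltaTheta]

theorem sig_neg (r θ : ℝ) : Sig (-a) r θ = Sig a r θ := by
  simp [Sig]

/-- Only `ρ̃` distinguishes `a` from `-a` in the spin coefficients. The conjugated coefficients
acting on `G₁, G₂` are therefore those of `-a`, and one computation serves both chiralities. -/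
theorem rhoT_neg : rhoT (-a) x = conj (rhoT a x) := by
  simp only [rhoT, map_add, map_mul, Complex.conj_ofReal, Complex.conj_I, neg_mul,
    Complex.ofReal_neg, mul_neg]

theorem spinMu_neg : spinMu L M (-a) x = conj (spinMu L M a x) := by
  simp only [spinMu, rhoT_neg, deltaR_neg, sig_neg, map_mul, map_div₀, map_one, Complex.conj_ofReal]

theorem spinEps_neg : spinEps L M (-a) x = conj (spinEps L M a x) := by
  simp only [spinEps, spinMu_neg, deltaR_neg, sig_neg, map_mul, map_sub, map_div₀, map_one,
    Complex.conj_ofReal, map_ofNat]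

theorem spinAlpha_neg : spinAlpha L (-a) x = conj (spinAlpha L a x) := by
  simp only [spinAlpha, rhoT_neg, deltaTheta_neg, sig_neg, map_mul, map_add, map_div₀, map_one,
    Complex.conj_ofReal, map_ofNat, Complex.conj_I, neg_mul, Complex.ofReal_neg, mul_neg]

theorem spinTau_neg : spinTau L (-a) x = conj (spinTau L a x) := by
  simp only [spinTau, rhoT_neg, deltaTheta_neg, sig_neg, map_mul, map_neg, map_div₀,
    Complex.conj_ofReal, Complex.conj_I, neg_mul, Complex.ofReal_neg, mul_neg]

theorem separatedSpinor_eq (Rm Rp Sm Sp : ℝ → ℂ) :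
    separatedSpinor L M a ω k Rm Rp Sm Sp x =
      ![amplitude L M a ω k x * (Rm (x 1) * Sp (x 2)),
        amplitude L M a ω k x * (Rp (x 1) * Sm (x 2)),
        amplitude L M (-a) ω k x * (Rp (x 1) * Sp (x 2)),
        amplitude L M (-a) ω k x * (Rm (x 1) * Sm (x 2))] := by
  simp only [separatedSpinor, amplitude, deltaR_neg, deltaTheta_neg, rhoT_neg]

end Parity

/-! ### The amplitude and its partial derivatives -/

section Amplitude

variable {L M a ω : ℝ} {k : ℤ} {x : Fin 4 → ℝ}

theorem rhoT_mem_slitPlane (hx : 0 < x 1) : rhoT a x ∈ Complex.slitPlane := by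
  refine Or.inl ?_
  simpa [rhoT] using hx

theorem rhoT_ne_zero (hx : 0 < x 1) : rhoT a x ≠ 0 :=
  Complex.slitPlane_ne_zero (rhoT_mem_slitPlane hx)

theorem deltaTheta_pos (hL : 0 < L) (θ : ℝ) : 0 < DeltaTheta L a θ := by
  unfold DeltaTheta
  positivity

theorem sig_pos {r : ℝ} (hr : 0 < r) (θ : ℝ) : 0 < Sig a r θ := by
  unfold Sig
  positivity

theorem amplitude_ne_zero (hL : 0 < L) (hx : 0 < x 1) (hΔ : 0 < DeltaR L M a (x 1)) :
    amplitude L M a ω k x ≠ 0 := by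
  have hT := deltaTheta_pos (a := a) hL (x 2)
  refine mul_ne_zero (mul_ne_zero (mul_ne_zero ?_ (Complex.exp_ne_zero _))
    (Complex.exp_ne_zero _)) ?_
  · exact Complex.ofReal_ne_zero.2 (Real.rpow_pos_of_pos (mul_pos hΔ hT) _).ne'
  · rw [Complex.cpow_def_of_ne_zero (rhoT_ne_zero hx)]
    exact Complex.exp_ne_zero _

/-- Multiplication by `√Σ` exchanges the amplitudes of the two chiralities. -/
theorem amplitude_mul_sqrt_sig (hx : 0 < x 1) :
    amplitude L M a ω k x * (Real.sqrt (Sig a (x 1) (x 2)) : ℂ) =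
      amplitude L M (-a) ω k x * rhoT (-a) x := by
  have hρ := rhoT_ne_zero (a := a) hx
  set q : ℂ := rhoT a x ^ (-(1 / 2) : ℂ) with hq
  have hq0 : q ≠ 0 := by
    rw [hq, Complex.cpow_def_of_ne_zero hρ]
    exact Complex.exp_ne_zero _
  -- Conjugation commutes with the principal power off the negative axis, and `Re ρ̃ = r > 0`.
  have hconj : rhoT (-a) x ^ (-(1 / 2) : ℂ) = conj q := by
    rw [rhoT_neg, Complex.conj_cpow _ _ (Complex.slitPlane_arg_ne_pi (rhoT_mem_slitPlane hx))]
    rw [hq, map_neg, map_div₀, map_one, map_ofNat]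
  have hsq : q * q * rhoT a x = 1 := by
    rw [hq, ← Complex.cpow_add _ _ hρ]
    norm_num
    rw [Complex.cpow_neg_one, inv_mul_cancel₀ hρ]
  have hSig : Sig a (x 1) (x 2) = ‖rhoT a x‖ ^ 2 := by
    rw [← Complex.normSq_eq_norm_sq, Complex.normSq_apply]
    simp only [rhoT, Sig, Complex.add_re, Complex.add_im, Complex.I_mul_re, Complex.I_mul_im,
      Complex.ofReal_re, Complex.ofReal_im]
    ring
  have hn : ‖q‖ ^ 2 * ‖rhoT a x‖ = 1 := by
    have := congrArg norm hsq
    rw [norm_mul, norm_mul, norm_one] at this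
    rw [sq]
    exact this
  -- Here `√Σ = |ρ̃|` and `q² ρ̃ = 1`; after multiplication by `conj q` both sides equal 1.
  have hmain : q * (Real.sqrt (Sig a (x 1) (x 2)) : ℂ) = conj q * rhoT (-a) x := by
    rw [hSig, Real.sqrt_sq (norm_nonneg _)]
    have h1 : conj q * conj q * rhoT (-a) x = 1 := by
      rw [rhoT_neg, ← map_mul, ← map_mul, hsq, map_one]
    have h2 : q * conj q * (‖rhoT a x‖ : ℂ) = 1 := by
      rw [Complex.mul_conj, Complex.normSq_eq_norm_sq]
      exact_mod_cast hn
    have hc : conj q ≠ 0 := (map_ne_zero _).2 hq0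
    refine mul_left_cancel₀ hc ?_
    linear_combination h2 - h1
  simp only [amplitude, deltaR_neg, deltaTheta_neg]
  rw [hconj, mul_assoc _ q, hmain, mul_assoc _ (conj q)]

theorem hasDerivAt_fderiv_single {f : (Fin 4 → ℝ) → ℂ} (hf : DifferentiableAt ℝ f x) (i : Fin 4) :
    HasDerivAt (fun t => f (Function.update x i t)) (fderiv ℝ f x (Pi.single i 1)) (x i) :=
  HasFDerivAt.comp_hasDerivAt_of_eq (x i) hf.hasFDerivAt (hasDerivAt_update x i (x i))
    (Function.update_eq_self i x).symm

theorem hasDerivAt_amplitude_zero :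
    HasDerivAt (fun t => amplitude L M a ω k (Function.update x 0 t))
      (amplitude L M a ω k x * (Complex.I * ω)) (x 0) := by
  have h : HasDerivAt (fun t : ℝ => Complex.exp (Complex.I * ((ω * t : ℝ) : ℂ)))
      (Complex.exp (Complex.I * ((ω * x 0 : ℝ) : ℂ)) * (Complex.I * ((ω * 1 : ℝ) : ℂ))) (x 0) :=
    ((((hasDerivAt_id (x 0)).const_mul ω).ofReal_comp).const_mul Complex.I).cexp
  have h' := ((h.const_mul (((DeltaR L M a (x 1) * DeltaTheta L a (x 2)) ^ (-(1 / 4) : ℝ) : ℝ) : ℂ)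
    ).mul_const (Complex.exp (Complex.I * ((khat k * x 3 : ℝ) : ℂ)))).mul_const
      (rhoT a x ^ (-(1 / 2) : ℂ))
  simp only [amplitude, rhoT] at h' ⊢
  refine h'.congr_deriv ?_
  simp only [mul_one]
  ring

theorem hasDerivAt_amplitude_three :
    HasDerivAt (fun t => amplitude L M a ω k (Function.update x 3 t))
      (amplitude L M a ω k x * (Complex.I * khat k)) (x 3) := by
  have h : HasDerivAt (fun t : ℝ => Complex.exp (Complex.I * ((khat k * t : ℝ) : ℂ)))
      (Complex.exp (Complex.I * ((khat k * x 3 : ℝ) : ℂ)) * (Complex.I * ((khat k * 1 : ℝ) : ℂ)))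
      (x 3) :=
    ((((hasDerivAt_id (x 3)).const_mul (khat k)).ofReal_comp).const_mul Complex.I).cexp
  have h' := (h.const_mul ((((DeltaR L M a (x 1) * DeltaTheta L a (x 2)) ^ (-(1 / 4) : ℝ) : ℝ) : ℂ)
    * Complex.exp (Complex.I * ((ω * x 0 : ℝ) : ℂ)))).mul_const (rhoT a x ^ (-(1 / 2) : ℂ))
  simp only [amplitude, rhoT] at h' ⊢
  refine h'.congr_deriv ?_
  simp only [mul_one]
  ring

theorem hasDerivAt_rpow_neg_quarter {p : ℝ → ℝ} {p' t : ℝ} (hp : HasDerivAt p p' t) (h0 : 0 < p t) :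
    HasDerivAt (fun t => ((p t ^ (-(1 / 4) : ℝ) : ℝ) : ℂ))
      (((p t ^ (-(1 / 4) : ℝ) : ℝ) : ℂ) * (-(p' / (4 * p t)) : ℝ)) t := by
  refine (hp.rpow_const (Or.inl h0.ne')).ofReal_comp.congr_deriv ?_
  rw [Real.rpow_sub_one h0.ne', ← Complex.ofReal_mul]
  congr 1
  field_simp

theorem hasDerivAt_cpow_neg_half {p : ℝ → ℂ} {p' : ℂ} {t : ℝ} (hp : HasDerivAt p p' t)
    (h0 : p t ∈ Complex.slitPlane) :
    HasDerivAt (fun t => p t ^ (-(1 / 2) : ℂ))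
      (p t ^ (-(1 / 2) : ℂ) * (-(p' / (2 * p t)))) t := by
  have h := (Complex.hasStrictDerivAt_cpow_const (c := (-(1 / 2) : ℂ)) h0).hasDerivAt.comp t hp
  refine h.congr_deriv ?_
  have := Complex.slitPlane_ne_zero h0
  rw [Complex.cpow_sub _ _ this, Complex.cpow_one]
  field_simp

theorem differentiable_deltaR : Differentiable ℝ (DeltaR L M a) := by
  unfold DeltaR
  fun_prop

theorem differentiable_deltaTheta : Differentiable ℝ (DeltaTheta L a) := by
  unfold DeltaTheta
  fun_prop

theorem hasDerivAt_amplitude_one (hL : 0 < L) (hx : 0 < x 1) (hΔ : 0 < DeltaR L M a (x 1)) :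
    HasDerivAt (fun t => amplitude L M a ω k (Function.update x 1 t))
      (amplitude L M a ω k x *
        (-((deriv (DeltaR L M a) (x 1) / (4 * DeltaR L M a (x 1)) : ℝ) : ℂ)
          - 1 / (2 * rhoT a x))) (x 1) := by
  have hT := deltaTheta_pos (a := a) hL (x 2)
  have h1 := hasDerivAt_rpow_neg_quarter
    ((differentiable_deltaR (L := L) (M := M) (a := a) (x 1)).hasDerivAt.mul_const
      (DeltaTheta L a (x 2))) (mul_pos hΔ hT)
  have h2 : HasDerivAt (fun t : ℝ => (t : ℂ) + Complex.I * ((a * Real.cos (x 2) : ℝ) : ℂ)) 1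
      (x 1) := ((hasDerivAt_id (x 1)).ofReal_comp).add_const _
  have h3 := hasDerivAt_cpow_neg_half h2 (rhoT_mem_slitPlane (a := a) hx)
  have h4 := ((h1.mul_const (Complex.exp (Complex.I * ((ω * x 0 : ℝ) : ℂ)))).mul_const
    (Complex.exp (Complex.I * ((khat k * x 3 : ℝ) : ℂ)))).mul h3
  have e : deriv (DeltaR L M a) (x 1) * DeltaTheta L a (x 2)
      / (4 * (DeltaR L M a (x 1) * DeltaTheta L a (x 2))) =
      deriv (DeltaR L M a) (x 1) / (4 * DeltaR L M a (x 1)) := by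
    field_simp
  rw [e] at h4
  refine h4.congr_deriv ?_
  simp only [amplitude, rhoT]
  push_cast
  ring

theorem hasDerivAt_amplitude_two (hL : 0 < L) (hx : 0 < x 1) (hΔ : 0 < DeltaR L M a (x 1)) :
    HasDerivAt (fun t => amplitude L M a ω k (Function.update x 2 t))
      (amplitude L M a ω k x *
        (-((deriv (DeltaTheta L a) (x 2) / (4 * DeltaTheta L a (x 2)) : ℝ) : ℂ)
          + Complex.I * ((a * Real.sin (x 2) : ℝ) : ℂ) / (2 * rhoT a x))) (x 2) := by
  have hT := deltaTheta_pos (a := a) hL (x 2)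
  have h1 := hasDerivAt_rpow_neg_quarter
    ((differentiable_deltaTheta (L := L) (a := a) (x 2)).hasDerivAt.const_mul
      (DeltaR L M a (x 1))) (mul_pos hΔ hT)
  have h2 : HasDerivAt (fun t : ℝ => (x 1 : ℂ) + Complex.I * ((a * Real.cos t : ℝ) : ℂ))
      (Complex.I * ((a * -Real.sin (x 2) : ℝ) : ℂ)) (x 2) :=
    ((((Real.hasDerivAt_cos (x 2)).const_mul a).ofReal_comp).const_mul Complex.I).const_add _
  have h3 := hasDerivAt_cpow_neg_half h2 (rhoT_mem_slitPlane (a := a) hx)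
  have h4 := ((h1.mul_const (Complex.exp (Complex.I * ((ω * x 0 : ℝ) : ℂ)))).mul_const
    (Complex.exp (Complex.I * ((khat k * x 3 : ℝ) : ℂ)))).mul h3
  have e : DeltaR L M a (x 1) * deriv (DeltaTheta L a) (x 2)
      / (4 * (DeltaR L M a (x 1) * DeltaTheta L a (x 2))) =
      deriv (DeltaTheta L a) (x 2) / (4 * DeltaTheta L a (x 2)) := by
    field_simp
  rw [e] at h4
  refine h4.congr_deriv ?_
  simp only [amplitude, rhoT]
  push_cast
  ring

variable {f : (Fin 4 → ℝ) → ℂ} {R S : ℝ → ℂ}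

/-- Since `f` is differentiable, each of its partial derivatives is, by uniqueness, the one-variable
derivative of the product along a coordinate line. -/
theorem dirDeriv_separated (hL : 0 < L) (hx : 0 < x 1) (hΔ : 0 < DeltaR L M a (x 1))
    (hf : DifferentiableAt ℝ f x)
    (hfe : f =ᶠ[nhds x] fun z => amplitude L M a ω k z * (R (z 1) * S (z 2)))
    (hR : DifferentiableAt ℝ R (x 1)) (hS : DifferentiableAt ℝ S (x 2)) (X : Fin 4 → ℂ) :
    dirDeriv X f x = amplitude L M a ω k x *
      (X 0 * (Complex.I * ω * (R (x 1) * S (x 2)))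
      + X 1 * ((-((deriv (DeltaR L M a) (x 1) / (4 * DeltaR L M a (x 1)) : ℝ) : ℂ)
          - 1 / (2 * rhoT a x)) * (R (x 1) * S (x 2)) + deriv R (x 1) * S (x 2))
      + X 2 * ((-((deriv (DeltaTheta L a) (x 2) / (4 * DeltaTheta L a (x 2)) : ℝ) : ℂ)
          + Complex.I * ((a * Real.sin (x 2) : ℝ) : ℂ) / (2 * rhoT a x)) * (R (x 1) * S (x 2))
          + R (x 1) * deriv S (x 2))
      + X 3 * (Complex.I * khat k * (R (x 1) * S (x 2)))) := by
  have hup : ∀ i : Fin 4, (fun t => f (Function.update x i t)) =ᶠ[nhds (x i)]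
      fun t => amplitude L M a ω k (Function.update x i t) *
        (R (Function.update x i t 1) * S (Function.update x i t 2)) := by
    intro i
    have hc : Filter.Tendsto (fun t => Function.update x i t) (nhds (x i)) (nhds x) := by
      have := (hasDerivAt_update x i (x i)).continuousAt.tendsto
      rwa [Function.update_eq_self] at this
    exact hc.eventually hfe
  have hd : ∀ i : Fin 4, HasDerivAt (fun t => amplitude L M a ω k (Function.update x i t) *
        (R (Function.update x i t 1) * S (Function.update x i t 2)))
        (fderiv ℝ f x (Pi.single i 1)) (x i) := fun i =>
    (hasDerivAt_fderiv_single hf i).congr_of_eventuallyEq (hup i).symm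
  have d0 := (hd 0).unique
    ((hasDerivAt_amplitude_zero (L := L) (M := M) (a := a) (ω := ω) (k := k) (x := x)).mul_const
      (R (x 1) * S (x 2)))
  have d3 := (hd 3).unique
    ((hasDerivAt_amplitude_three (L := L) (M := M) (a := a) (ω := ω) (k := k) (x := x)).mul_const
      (R (x 1) * S (x 2)))
  have d1 := (hd 1).unique
    ((hasDerivAt_amplitude_one (ω := ω) (k := k) hL hx hΔ).mul (hR.hasDerivAt.mul_const (S (x 2))))
  have d2 := (hd 2).unique
    ((hasDerivAt_amplitude_two (ω := ω) (k := k) hL hx hΔ).mul (hS.hasDerivAt.const_mul (R (x 1))))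
  simp only [Function.update_eq_self] at d1 d2
  rw [dirDeriv, Fin.sum_univ_four, d0, d1, d2, d3]
  ring

/-- A bound state carries no regularity assumption on its factors. On a radial line `R` is the
quotient of `f` by the amplitude and the constant value of `S`. -/
theorem differentiableAt_radial_of_separated (hL : 0 < L) (hx : 0 < x 1)
    (hΔ : 0 < DeltaR L M a (x 1)) (hf : DifferentiableAt ℝ f x)
    (hfe : f =ᶠ[nhds x] fun z => amplitude L M a ω k z * (R (z 1) * S (z 2)))
    (hS : S (x 2) ≠ 0) : DifferentiableAt ℝ R (x 1) := by
  have hc : Filter.Tendsto (fun t => Function.update x 1 t) (nhds (x 1)) (nhds x) := by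
    have := (hasDerivAt_update x 1 (x 1)).continuousAt.tendsto
    rwa [Function.update_eq_self] at this
  have hA := hasDerivAt_amplitude_one (ω := ω) (k := k) hL hx hΔ
  have hA0 : amplitude L M a ω k (Function.update x 1 (x 1)) ≠ 0 := by
    rw [Function.update_eq_self]
    exact amplitude_ne_zero hL hx hΔ
  have hquot := (hasDerivAt_fderiv_single hf 1).differentiableAt.div
    (hA.mul_const (S (x 2))).differentiableAt (mul_ne_zero hA0 hS)
  refine hquot.congr_of_eventuallyEq ?_
  filter_upwards [hc.eventually hfe, hA.continuousAt.eventually_ne hA0] with t ht ht0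
  have ht' : f (Function.update x 1 t) =
    amplitude L M a ω k (Function.update x 1 t) * (R t * S (x 2)) := ht
  simp only [Pi.div_apply]
  rw [ht']
  field_simp

theorem differentiableAt_angular_of_separated (hL : 0 < L) (hx : 0 < x 1)
    (hΔ : 0 < DeltaR L M a (x 1)) (hf : DifferentiableAt ℝ f x)
    (hfe : f =ᶠ[nhds x] fun z => amplitude L M a ω k z * (R (z 1) * S (z 2)))
    (hR : R (x 1) ≠ 0) : DifferentiableAt ℝ S (x 2) := by
  have hc : Filter.Tendsto (fun t => Function.update x 2 t) (nhds (x 2)) (nhds x) := by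
    have := (hasDerivAt_update x 2 (x 2)).continuousAt.tendsto
    rwa [Function.update_eq_self] at this
  have hA := hasDerivAt_amplitude_two (ω := ω) (k := k) hL hx hΔ
  have hA0 : amplitude L M a ω k (Function.update x 2 (x 2)) ≠ 0 := by
    rw [Function.update_eq_self]
    exact amplitude_ne_zero hL hx hΔ
  have hquot := (hasDerivAt_fderiv_single hf 2).differentiableAt.div
    (hA.mul_const (R (x 1))).differentiableAt (mul_ne_zero hA0 hR)
  refine hquot.congr_of_eventuallyEq ?_
  filter_upwards [hc.eventually hfe, hA.continuousAt.eventually_ne hA0] with t ht ht0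
  have ht' : f (Function.update x 2 t) =
    amplitude L M a ω k (Function.update x 2 t) * (R (x 1) * S t) := ht
  simp only [Pi.div_apply]
  rw [ht']
  field_simp

end Amplitude

/-! ### The entries of the Dirac operator on separated spinors -/

section Entries

variable {L M a b ω : ℝ} {k : ℤ} {x : Fin 4 → ℝ} {f : (Fin 4 → ℝ) → ℂ} {R S : ℝ → ℂ}

/-- The radial potential term `V`, after division by `√Δ_r`. -/
theorem sqrt_deltaR_mul_potV (hΔ : 0 < DeltaR L M a (x 1)) :
    (Real.sqrt (DeltaR L M a (x 1)) : ℂ) * ((potV L a ω k (x 1) / DeltaR L M a (x 1) : ℝ) : ℂ) =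
      ((potV L a ω k (x 1) / Real.sqrt (DeltaR L M a (x 1)) : ℝ) : ℂ) := by
  rw [← Complex.ofReal_mul]
  congr 1
  have hd : 0 < Real.sqrt (DeltaR L M a (x 1)) := Real.sqrt_pos.2 hΔ
  nth_rewrite 2 [← Real.sq_sqrt hΔ.le]
  field_simp

/-- The logarithmic `r`-derivative `-Δ_r'/(4Δ_r) - 1/(2ρ̃)` of the amplitude, times the
`r`-component of `l`, is exactly `-(ε - ρ)`; the `t` and `φ` derivatives combine to `V`. The tetrad
keeps `a`, while `b = ± a` selects the chirality. -/
theorem dirDeriv_vecL_separated (hb : b ^ 2 = a ^ 2) (hL : 0 < L) (hx : 0 < x 1)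
    (hΔ : 0 < DeltaR L M a (x 1)) (hf : DifferentiableAt ℝ f x)
    (hfe : f =ᶠ[nhds x] fun z => amplitude L M b ω k z * (R (z 1) * S (z 2)))
    (hR : DifferentiableAt ℝ R (x 1)) (hS : DifferentiableAt ℝ S (x 2)) :
    dirDeriv (vecL L M a x) f x + (spinEps L M b x - spinMu L M b x) * f x =
      -(amplitude L M b ω k x * S (x 2) / (Real.sqrt (2 * Sig a (x 1) (x 2)) : ℂ)) *
        ((Real.sqrt (DeltaR L M a (x 1)) : ℂ) *
        (deriv R (x 1) - Complex.I * ((potV L a ω k (x 1) / DeltaR L M a (x 1) : ℝ) : ℂ)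
          * R (x 1))) := by
  have hbΔ : DeltaR L M b = DeltaR L M a := by funext r; simp only [DeltaR, hb]
  have hbS : Sig b (x 1) (x 2) = Sig a (x 1) (x 2) := by simp only [Sig, hb]
  have hρ := rhoT_ne_zero (a := b) hx
  have hX : 0 < Real.sqrt (2 * Sig a (x 1) (x 2)) :=
    Real.sqrt_pos.2 (mul_pos two_pos (sig_pos hx _))
  have hd : 0 < Real.sqrt (DeltaR L M a (x 1)) := Real.sqrt_pos.2 hΔ
  have e1 : Real.sqrt (2 * Sig a (x 1) (x 2) * DeltaR L M a (x 1)) =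
    Real.sqrt (2 * Sig a (x 1) (x 2)) * Real.sqrt (DeltaR L M a (x 1)) :=
    Real.sqrt_mul (mul_pos two_pos (sig_pos hx _)).le _
  have e2 := Real.sqrt_div hΔ.le (2 * Sig a (x 1) (x 2))
  have e3 : (Real.sqrt (DeltaR L M a (x 1)) : ℂ) ^ 2 = (DeltaR L M a (x 1) : ℂ) := by
    exact_mod_cast Real.sq_sqrt hΔ.le
  rw [mul_sub (Real.sqrt (DeltaR L M a (x 1)) : ℂ), mul_comm Complex.I, mul_assoc,
    ← mul_assoc _ _ (Complex.I * _), sqrt_deltaR_mul_potV hΔ,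
    dirDeriv_separated hL hx (by rwa [hbΔ]) hf hfe hR hS, hfe.self_of_nhds]
  simp only [spinEps, spinMu, vecL, hbΔ, hbS, e1, e2, Matrix.cons_val]
  push_cast
  rw [← e3]
  have hXc : (Real.sqrt (2 * Sig a (x 1) (x 2)) : ℂ) ≠ 0 := by exact_mod_cast hX.ne'
  have hdc : (Real.sqrt (DeltaR L M a (x 1)) : ℂ) ≠ 0 := by exact_mod_cast hd.ne'
  simp only [potV]
  push_cast
  field_simp
  ring

theorem dirDeriv_vecN_separated (hb : b ^ 2 = a ^ 2) (hL : 0 < L) (hx : 0 < x 1)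
    (hΔ : 0 < DeltaR L M a (x 1)) (hf : DifferentiableAt ℝ f x)
    (hfe : f =ᶠ[nhds x] fun z => amplitude L M b ω k z * (R (z 1) * S (z 2)))
    (hR : DifferentiableAt ℝ R (x 1)) (hS : DifferentiableAt ℝ S (x 2)) :
    dirDeriv (vecN L M a x) f x + (spinMu L M b x - spinEps L M b x) * f x =
      amplitude L M b ω k x * S (x 2) / (Real.sqrt (2 * Sig a (x 1) (x 2)) : ℂ) *
        ((Real.sqrt (DeltaR L M a (x 1)) : ℂ) *
        (deriv R (x 1) + Complex.I * ((potV L a ω k (x 1) / DeltaR L M a (x 1) : ℝ) : ℂ)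
          * R (x 1))) := by
  have hbΔ : DeltaR L M b = DeltaR L M a := by funext r; simp only [DeltaR, hb]
  have hbS : Sig b (x 1) (x 2) = Sig a (x 1) (x 2) := by simp only [Sig, hb]
  have hρ := rhoT_ne_zero (a := b) hx
  have hX : 0 < Real.sqrt (2 * Sig a (x 1) (x 2)) :=
    Real.sqrt_pos.2 (mul_pos two_pos (sig_pos hx _))
  have hd : 0 < Real.sqrt (DeltaR L M a (x 1)) := Real.sqrt_pos.2 hΔ
  have e1 : Real.sqrt (2 * Sig a (x 1) (x 2) * DeltaR L M a (x 1)) =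
    Real.sqrt (2 * Sig a (x 1) (x 2)) * Real.sqrt (DeltaR L M a (x 1)) :=
    Real.sqrt_mul (mul_pos two_pos (sig_pos hx _)).le _
  have e2 := Real.sqrt_div hΔ.le (2 * Sig a (x 1) (x 2))
  have e3 : (Real.sqrt (DeltaR L M a (x 1)) : ℂ) ^ 2 = (DeltaR L M a (x 1) : ℂ) := by
    exact_mod_cast Real.sq_sqrt hΔ.le
  rw [mul_add (Real.sqrt (DeltaR L M a (x 1)) : ℂ), mul_comm Complex.I, mul_assoc,
    ← mul_assoc _ _ (Complex.I * _), sqrt_deltaR_mul_potV hΔ,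
    dirDeriv_separated hL hx (by rwa [hbΔ]) hf hfe hR hS, hfe.self_of_nhds]
  simp only [spinEps, spinMu, vecN, hbΔ, hbS, e1, e2, Matrix.cons_val]
  push_cast
  rw [← e3]
  have hXc : (Real.sqrt (2 * Sig a (x 1) (x 2)) : ℂ) ≠ 0 := by exact_mod_cast hX.ne'
  have hdc : (Real.sqrt (DeltaR L M a (x 1)) : ℂ) ≠ 0 := by exact_mod_cast hd.ne'
  simp only [potV]
  push_cast
  field_simp
  ring

/-- `-√Δ_θ (d/dθ + cot θ / 2) S + (± Ξ (a ω sin θ + (k + 1/2) / sin θ)) S / √Δ_θ`, the sign being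
that of `σ`. -/
noncomputable def angularOp (L a ω σ : ℝ) (k : ℤ) (S : ℝ → ℂ) (θ : ℝ) : ℂ :=
  -(Real.sqrt (DeltaTheta L a θ) : ℂ)
      * (deriv S θ + ((Real.cos θ / Real.sin θ / 2 : ℝ) : ℂ) * S θ)
    + ((σ * (Xi L a * (a * ω * Real.sin θ + khat k / Real.sin θ))
        / Real.sqrt (DeltaTheta L a θ) : ℝ) : ℂ) * S θ

/-- The `Δ_θ'` and `ρ̃` terms of the amplitude cancel those of `-τ - α`, and only half a cotangent
remains. As `β = -α` and `π = -τ`, this one coefficient covers both `β - τ` and `π - α`. -/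
theorem dirDeriv_vecM_separated (hb : b ^ 2 = a ^ 2) (hL : 0 < L) (hx : 0 < x 1)
    (hΔ : 0 < DeltaR L M a (x 1)) (hs : 0 < Real.sin (x 2)) (hf : DifferentiableAt ℝ f x)
    (hfe : f =ᶠ[nhds x] fun z => amplitude L M b ω k z * (R (z 1) * S (z 2)))
    (hR : DifferentiableAt ℝ R (x 1)) (hS : DifferentiableAt ℝ S (x 2)) :
    dirDeriv (vecM L a x) f x + (-spinTau L b x - spinAlpha L b x) * f x =
      amplitude L M b ω k x * R (x 1) / (Real.sqrt (2 * Sig a (x 1) (x 2)) : ℂ) *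
        angularOp L a ω 1 k S (x 2) := by
  have hbΔ : DeltaR L M b = DeltaR L M a := by funext r; simp only [DeltaR, hb]
  have hbT : DeltaTheta L b = DeltaTheta L a := by funext r; simp only [DeltaTheta, hb]
  have hbS : Sig b (x 1) (x 2) = Sig a (x 1) (x 2) := by simp only [Sig, hb]
  have hT := deltaTheta_pos (a := a) hL (x 2)
  have hρ := rhoT_ne_zero (a := b) hx
  have hX : 0 < Real.sqrt (2 * Sig a (x 1) (x 2)) :=
    Real.sqrt_pos.2 (mul_pos two_pos (sig_pos hx _))
  have hd : 0 < Real.sqrt (DeltaTheta L a (x 2)) := Real.sqrt_pos.2 hT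
  have e1 : Real.sqrt (2 * Sig a (x 1) (x 2) * DeltaTheta L a (x 2)) =
    Real.sqrt (2 * Sig a (x 1) (x 2)) * Real.sqrt (DeltaTheta L a (x 2)) :=
    Real.sqrt_mul (mul_pos two_pos (sig_pos hx _)).le _
  have e2 := Real.sqrt_div hT.le (2 * Sig a (x 1) (x 2))
  have e3 : (Real.sqrt (DeltaTheta L a (x 2)) : ℂ) ^ 2 = (DeltaTheta L a (x 2) : ℂ) := by
    exact_mod_cast Real.sq_sqrt hT.le
  rw [dirDeriv_separated hL hx (by rwa [hbΔ]) hf hfe hR hS, hfe.self_of_nhds]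
  simp only [spinTau, spinAlpha, vecM, angularOp, hbT, hbS, e1, e2, Matrix.cons_val]
  push_cast
  rw [← e3]
  have hXc : (Real.sqrt (2 * Sig a (x 1) (x 2)) : ℂ) ≠ 0 := by exact_mod_cast hX.ne'
  have hdc : (Real.sqrt (DeltaTheta L a (x 2)) : ℂ) ≠ 0 := by exact_mod_cast hd.ne'
  have hsc : Complex.sin (x 2 : ℂ) ≠ 0 := by exact_mod_cast hs.ne'
  field_simp
  ring_nf
  simp only [Complex.I_sq]
  ring

/-- The `θ`-component of `m` is real, so conjugation only reverses the sign of the `t` and `φ`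
terms. -/
theorem dirDeriv_vecMbar_separated (hb : b ^ 2 = a ^ 2) (hL : 0 < L) (hx : 0 < x 1)
    (hΔ : 0 < DeltaR L M a (x 1)) (hs : 0 < Real.sin (x 2)) (hf : DifferentiableAt ℝ f x)
    (hfe : f =ᶠ[nhds x] fun z => amplitude L M b ω k z * (R (z 1) * S (z 2)))
    (hR : DifferentiableAt ℝ R (x 1)) (hS : DifferentiableAt ℝ S (x 2)) :
    dirDeriv (vecMbar L a x) f x + (-spinTau L b x - spinAlpha L b x) * f x =
      amplitude L M b ω k x * R (x 1) / (Real.sqrt (2 * Sig a (x 1) (x 2)) : ℂ) *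
        angularOp L a ω (-1) k S (x 2) := by
  have hbΔ : DeltaR L M b = DeltaR L M a := by funext r; simp only [DeltaR, hb]
  have hbT : DeltaTheta L b = DeltaTheta L a := by funext r; simp only [DeltaTheta, hb]
  have hbS : Sig b (x 1) (x 2) = Sig a (x 1) (x 2) := by simp only [Sig, hb]
  have hT := deltaTheta_pos (a := a) hL (x 2)
  have hρ := rhoT_ne_zero (a := b) hx
  have hX : 0 < Real.sqrt (2 * Sig a (x 1) (x 2)) :=
    Real.sqrt_pos.2 (mul_pos two_pos (sig_pos hx _))
  have hd : 0 < Real.sqrt (DeltaTheta L a (x 2)) := Real.sqrt_pos.2 hT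
  have e1 : Real.sqrt (2 * Sig a (x 1) (x 2) * DeltaTheta L a (x 2)) =
    Real.sqrt (2 * Sig a (x 1) (x 2)) * Real.sqrt (DeltaTheta L a (x 2)) :=
    Real.sqrt_mul (mul_pos two_pos (sig_pos hx _)).le _
  have e2 := Real.sqrt_div hT.le (2 * Sig a (x 1) (x 2))
  have e3 : (Real.sqrt (DeltaTheta L a (x 2)) : ℂ) ^ 2 = (DeltaTheta L a (x 2) : ℂ) := by
    exact_mod_cast Real.sq_sqrt hT.le
  rw [dirDeriv_separated hL hx (by rwa [hbΔ]) hf hfe hR hS, hfe.self_of_nhds]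
  simp only [spinTau, spinAlpha, vecMbar, vecM, angularOp, hbT, hbS, e1, e2, Matrix.cons_val,
    map_neg, map_mul, map_zero, Complex.conj_I, Complex.conj_ofReal]
  push_cast
  rw [← e3]
  have hXc : (Real.sqrt (2 * Sig a (x 1) (x 2)) : ℂ) ≠ 0 := by exact_mod_cast hX.ne'
  have hdc : (Real.sqrt (DeltaTheta L a (x 2)) : ℂ) ≠ 0 := by exact_mod_cast hd.ne'
  have hsc : Complex.sin (x 2 : ℂ) ≠ 0 := by exact_mod_cast hs.ne'
  field_simp
  ring_nf
  simp only [Complex.I_sq]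
  ring

end Entries

/-! ### Separation of the Dirac equation -/

section Separation

variable {L M a rneg rin rp rc m ω : ℝ} {k : ℤ} {Ψ : (Fin 4 → ℝ) → Fin 4 → ℂ}
  {Rm Rp Sm Sp : ℝ → ℂ}

theorem isOpen_exterior (rp rc : ℝ) : IsOpen (exterior rp rc) :=
  (isOpen_Ioo.preimage (continuous_apply 1)).inter (isOpen_Ioo.preimage (continuous_apply 2))

theorem separated_components
    (hsep : ∀ x ∈ exterior rp rc, Ψ x = separatedSpinor L M a ω k Rm Rp Sm Sp x)
    {x : Fin 4 → ℝ} (hx : x ∈ exterior rp rc) :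
    ((fun z => Ψ z 0) =ᶠ[nhds x] fun z => amplitude L M a ω k z * (Rm (z 1) * Sp (z 2))) ∧
    ((fun z => Ψ z 1) =ᶠ[nhds x] fun z => amplitude L M a ω k z * (Rp (z 1) * Sm (z 2))) ∧
    ((fun z => Ψ z 2) =ᶠ[nhds x] fun z => amplitude L M (-a) ω k z * (Rp (z 1) * Sp (z 2))) ∧
    ((fun z => Ψ z 3) =ᶠ[nhds x] fun z => amplitude L M (-a) ω k z * (Rm (z 1) * Sm (z 2))) := by
  have hev : ∀ᶠ z in nhds x, Ψ z = separatedSpinor L M a ω k Rm Rp Sm Sp z := by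
    filter_upwards [(isOpen_exterior rp rc).mem_nhds hx] with z hz using hsep z hz
  simp only [separatedSpinor_eq] at hev
  exact ⟨hev.mono fun z hz => congrFun hz 0, hev.mono fun z hz => congrFun hz 1,
    hev.mono fun z hz => congrFun hz 2, hev.mono fun z hz => congrFun hz 3⟩

/-- The radial and angular parts of the Dirac equation for a separated spinor. -/
theorem separated_equations (h : IsNonExtreme L M a rneg rin rp rc)
    (hD : IsDiracSolution L M a rp rc m Ψ)
    (hsep : ∀ x ∈ exterior rp rc, Ψ x = separatedSpinor L M a ω k Rm Rp Sm Sp x)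
    {r θ : ℝ} (hr : r ∈ Set.Ioo rp rc) (hθ : θ ∈ Set.Ioo 0 Real.pi)
    (hRm : DifferentiableAt ℝ Rm r) (hRp : DifferentiableAt ℝ Rp r)
    (hSm : DifferentiableAt ℝ Sm θ) (hSp : DifferentiableAt ℝ Sp θ)
    {X Y : ℂ}
    (hX : X = (Real.sqrt (DeltaR L M a r) : ℂ) *
        (deriv Rm r + Complex.I * ((potV L a ω k r / DeltaR L M a r : ℝ) : ℂ) * Rm r)
        - Complex.I * m * r * Rp r)
    (hY : Y = (Real.sqrt (DeltaR L M a r) : ℂ) *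
        (deriv Rp r - Complex.I * ((potV L a ω k r / DeltaR L M a r : ℝ) : ℂ) * Rp r)
        + Complex.I * m * r * Rm r) :
    (Sp θ * Y + Rm r * (angularOp L a ω 1 k Sm θ + m * (a * Real.cos θ : ℝ) * Sp θ) = 0 ∧
    Sp θ * X + Rp r * (angularOp L a ω 1 k Sm θ + m * (a * Real.cos θ : ℝ) * Sp θ) = 0) ∧
    Sm θ * Y - Rm r * (angularOp L a ω (-1) k Sp θ + m * (a * Real.cos θ : ℝ) * Sm θ) = 0 ∧
    Sm θ * X - Rp r * (angularOp L a ω (-1) k Sp θ + m * (a * Real.cos θ : ℝ) * Sm θ) = 0 := by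
  -- The values of `t` and `φ` do not matter, as they enter only through nonvanishing exponentials.
  set x : Fin 4 → ℝ := ![0, r, θ, 0]
  have hx : x ∈ exterior rp rc := ⟨hr, hθ⟩
  have hL := h.cosmological_pos
  have hr0 : 0 < x 1 := h.rp_pos.trans hr.1
  have hΔ : 0 < DeltaR L M a (x 1) := h.deltaR_pos hr
  have hs : 0 < Real.sin (x 2) := Real.sin_pos_of_mem_Ioo hθ
  obtain ⟨hd, hop⟩ := hD x hx
  have hdi := fun i => differentiableAt_pi.1 hd i
  obtain ⟨f0, f1, f2, f3⟩ := separated_components hsep hx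
  have ha : (-a) ^ 2 = a ^ 2 := neg_sq a
  have l1 := dirDeriv_vecL_separated rfl hL hr0 hΔ (hdi 1) f1 hRp hSm
  have l2 := dirDeriv_vecL_separated ha hL hr0 hΔ (hdi 2) f2 hRp hSp
  have n0 := dirDeriv_vecN_separated rfl hL hr0 hΔ (hdi 0) f0 hRm hSp
  have n3 := dirDeriv_vecN_separated ha hL hr0 hΔ (hdi 3) f3 hRm hSm
  have m1 := dirDeriv_vecM_separated rfl hL hr0 hΔ hs (hdi 1) f1 hRp hSm
  have m3 := dirDeriv_vecM_separated ha hL hr0 hΔ hs (hdi 3) f3 hRm hSm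
  have b0 := dirDeriv_vecMbar_separated rfl hL hr0 hΔ hs (hdi 0) f0 hRm hSp
  have b2 := dirDeriv_vecMbar_separated ha hL hr0 hΔ hs (hdi 2) f2 hRp hSp
  rw [spinEps_neg, spinMu_neg] at l2 n3
  rw [spinTau_neg, spinAlpha_neg] at m3 b2
  have v0 : Ψ x 0 = amplitude L M a ω k x * (Rm r * Sp θ) := f0.self_of_nhds
  have v1 : Ψ x 1 = amplitude L M a ω k x * (Rp r * Sm θ) := f1.self_of_nhds
  have v2 : Ψ x 2 = amplitude L M (-a) ω k x * (Rp r * Sp θ) := f2.self_of_nhds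
  have v3 : Ψ x 3 = amplitude L M (-a) ω k x * (Rm r * Sm θ) := f3.self_of_nhds
  have hE := amplitude_ne_zero (a := a) (ω := ω) (k := k) hL hr0 hΔ
  have hE' := amplitude_ne_zero (a := -a) (ω := ω) (k := k) hL hr0 (by rwa [deltaR_neg])
  have w := amplitude_mul_sqrt_sig (L := L) (M := M) (a := a) (ω := ω) (k := k) hr0
  have w' := amplitude_mul_sqrt_sig (L := L) (M := M) (a := -a) (ω := ω) (k := k) hr0
  rw [neg_neg, sig_neg] at w'
  have hSig : 0 < Real.sqrt (Sig a (x 1) (x 2)) := Real.sqrt_pos.2 (sig_pos hr0 _)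
  rw [Real.sqrt_mul two_pos.le] at l1 l2 n0 n3 m1 m3 b0 b2
  have q0 := congrFun hop 0
  have q1 := congrFun hop 1
  have q2 := congrFun hop 2
  have q3 := congrFun hop 3
  simp only [diracOp, Matrix.cons_val, Pi.zero_apply, map_neg] at q0 q1 q2 q3
  rw [l2, m3, v0] at q0
  rw [neg_sub_comm, b2, n3, v1] at q1
  rw [n0, neg_sub_comm, m1, v2] at q2
  rw [b0, l1, v3] at q3
  have x1 : x 1 = r := rfl
  have x2 : x 2 = θ := rfl
  have r1 : rhoT a x = (r : ℂ) + Complex.I * ((a * Real.cos θ : ℝ) : ℂ) := rfl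
  have r2 : rhoT (-a) x = (r : ℂ) - Complex.I * ((a * Real.cos θ : ℝ) : ℂ) := by
    rw [rhoT, x1, x2]
    push_cast
    ring
  rw [r2] at w
  rw [r1] at w'
  rw [x1] at q0 q1 q2 q3
  rw [x2, eq_sub_of_add_eq hY.symm, Complex.ofReal_mul] at q0 q3
  rw [x2, eq_add_of_sub_eq hX.symm, Complex.ofReal_mul] at q1 q2
  rw [x1, x2] at w w' hSig
  -- Naming the inverse of `√2 √Σ` as `j` makes the remaining identities polynomial.
  obtain ⟨j, hj⟩ : ∃ j : ℂ, j = ((Real.sqrt 2 : ℂ) * (Real.sqrt (Sig a r θ) : ℂ))⁻¹ := ⟨_, rfl⟩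
  have hj1 : (Real.sqrt 2 : ℂ) * (Real.sqrt (Sig a r θ) : ℂ) * j = 1 := by
    rw [hj]
    refine mul_inv_cancel₀ (mul_ne_zero ?_ (Complex.ofReal_ne_zero.2 hSig.ne'))
    exact Complex.ofReal_ne_zero.2 (Real.sqrt_pos.2 two_pos).ne'
  simp only [div_eq_mul_inv, ← hj] at q0 q1 q2 q3
  set E := amplitude L M a ω k x
  set E' := amplitude L M (-a) ω k x
  set A := angularOp L a ω 1 k Sm θ
  set B := angularOp L a ω (-1) k Sp θ
  set c : ℂ := ((a * Real.cos θ : ℝ) : ℂ)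
  set g : ℂ := (Real.sqrt (Sig a r θ) : ℂ)
  have hI := Complex.I_mul_I
  refine ⟨⟨?_, ?_⟩, ?_, ?_⟩
  -- Multiplying by `√Σ` turns the mass term's amplitude `E` into `E' (r - i a cos θ)` through `w`:
  -- the part with `r` joins `Y`, the part with `a cos θ` joins the angular operator. The other
  -- three equations are handled alike.
  · refine (mul_eq_zero.1 ?_).resolve_left (mul_ne_zero Complex.I_ne_zero hE')
    linear_combination g * q0 + m * Rm r * Sp θ * w
      - Complex.I * E' * (Sp θ * (Y - Complex.I * m * r * Rm r) + Rm r * A) * hj1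
      + E' * Sp θ * m * r * Rm r * hI
  · refine (mul_eq_zero.1 ?_).resolve_left (mul_ne_zero (neg_ne_zero.2 Complex.I_ne_zero) hE)
    linear_combination g * q2 + m * Rp r * Sp θ * w'
      + Complex.I * E * (Sp θ * (X + Complex.I * m * r * Rp r) + Rp r * A) * hj1
      + E * Sp θ * m * r * Rp r * hI
  · refine (mul_eq_zero.1 ?_).resolve_left (mul_ne_zero Complex.I_ne_zero hE)
    linear_combination g * q3 + m * Rm r * Sm θ * w'
      - Complex.I * E * (Sm θ * (Y - Complex.I * m * r * Rm r) - Rm r * B) * hj1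
      + E * Sm θ * m * r * Rm r * hI
  · refine (mul_eq_zero.1 ?_).resolve_left (mul_ne_zero (neg_ne_zero.2 Complex.I_ne_zero) hE')
    linear_combination g * q1 + m * Rp r * Sm θ * w
      + Complex.I * E' * (Sm θ * (X + Complex.I * m * r * Rp r) - Rp r * B) * hj1
      + E' * Sm θ * m * r * Rp r * hI

/-- The angle is frozen at that of a point where `Ψ` does not vanish. This yields the radial system
on all of `(rp, rc)`, hence zero radial functions, contradicting `Ψ ≠ 0` at that point. -/
theorem not_isBoundState (h : IsNonExtreme L M a rneg rin rp rc) :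
    ¬ IsBoundState L M a rp rc m Ψ := by
  rintro ⟨hD, ⟨x, hx, hne⟩, ω, k, Rm, Rp, Sm, Sp, hN, hsep⟩
  have hL := h.cosmological_pos
  have hS : Sp (x 2) ≠ 0 ∨ Sm (x 2) ≠ 0 := by
    by_contra! hc
    refine hne ?_
    rw [hsep x hx, separatedSpinor_eq, hc.1, hc.2]
    funext i
    fin_cases i <;> simp
  have hR : Rm (x 1) ≠ 0 ∨ Rp (x 1) ≠ 0 := by
    by_contra! hc
    refine hne ?_
    rw [hsep x hx, separatedSpinor_eq, hc.1, hc.2]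
    funext i
    fin_cases i <;> simp
  set θ := x 2
  have hθ : θ ∈ Set.Ioo 0 Real.pi := hx.2
  have hr0 : ∀ r ∈ Set.Ioo rp rc, 0 < r := fun r hr => h.rp_pos.trans hr.1
  have hΔ' : ∀ r ∈ Set.Ioo rp rc, 0 < DeltaR L M (-a) r := fun r hr => by
    rw [deltaR_neg]; exact h.deltaR_pos hr
  have hRd : ∀ r ∈ Set.Ioo rp rc, DifferentiableAt ℝ Rm r ∧ DifferentiableAt ℝ Rp r := by
    intro r hr
    have hy : (![0, r, θ, 0] : Fin 4 → ℝ) ∈ exterior rp rc := ⟨hr, hθ⟩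
    have hdi := fun i => differentiableAt_pi.1 (hD _ hy).1 i
    rcases hS with hS | hS
    · exact ⟨differentiableAt_radial_of_separated (x := ![0, r, θ, 0]) hL (hr0 r hr)
          (h.deltaR_pos hr) (hdi 0) (separated_components hsep hy).1 hS,
        differentiableAt_radial_of_separated (x := ![0, r, θ, 0]) hL (hr0 r hr)
          (hΔ' r hr) (hdi 2) (separated_components hsep hy).2.2.1 hS⟩
    · exact ⟨differentiableAt_radial_of_separated (x := ![0, r, θ, 0]) hL (hr0 r hr)
          (hΔ' r hr) (hdi 3) (separated_components hsep hy).2.2.2 hS,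
        differentiableAt_radial_of_separated (x := ![0, r, θ, 0]) hL (hr0 r hr)
          (h.deltaR_pos hr) (hdi 1) (separated_components hsep hy).2.1 hS⟩
  have hSd : DifferentiableAt ℝ Sm θ ∧ DifferentiableAt ℝ Sp θ := by
    have hdi := fun i => differentiableAt_pi.1 (hD _ hx).1 i
    have hx1 : x 1 ∈ Set.Ioo rp rc := hx.1
    rcases hR with hR | hR
    · exact ⟨differentiableAt_angular_of_separated hL (hr0 _ hx1) (hΔ' _ hx1) (hdi 3)
          (separated_components hsep hx).2.2.2 hR,
        differentiableAt_angular_of_separated hL (hr0 _ hx1) (h.deltaR_pos hx1) (hdi 0)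
          (separated_components hsep hx).1 hR⟩
    · exact ⟨differentiableAt_angular_of_separated hL (hr0 _ hx1) (h.deltaR_pos hx1) (hdi 1)
          (separated_components hsep hx).2.1 hR,
        differentiableAt_angular_of_separated hL (hr0 _ hx1) (hΔ' _ hx1) (hdi 2)
          (separated_components hsep hx).2.2.1 hR⟩
  have hrad : ∃ lam : ℂ, IsRadialSolution L M a rp rc m ω k lam Rm Rp := by
    rcases hS with hS | hS
    -- If `S₊` is nonzero at `θ`, the two equations containing `S₊ Y` and `S₊ X` give `Y = λ R₋` and
    -- `X = λ R₊` after division; otherwise the pair with `S₋` is used. The value of `λ` does not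
    -- depend on `r`.
    · refine ⟨-((angularOp L a ω 1 k Sm θ + m * (a * Real.cos θ : ℝ) * Sp θ) / Sp θ),
        fun r hr => ⟨(hRd r hr).1, (hRd r hr).2, ?_⟩⟩
      obtain ⟨⟨e1, e2⟩, -⟩ := separated_equations h hD hsep hr hθ (hRd r hr).1 (hRd r hr).2
        hSd.1 hSd.2 rfl rfl
      constructor
      · refine mul_left_cancel₀ hS ?_
        field_simp
        linear_combination e2
      · refine mul_left_cancel₀ hS ?_
        field_simp
        linear_combination e1
    · refine ⟨(angularOp L a ω (-1) k Sp θ + m * (a * Real.cos θ : ℝ) * Sm θ) / Sm θ,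
        fun r hr => ⟨(hRd r hr).1, (hRd r hr).2, ?_⟩⟩
      obtain ⟨-, e1, e2⟩ := separated_equations h hD hsep hr hθ (hRd r hr).1 (hRd r hr).2
        hSd.1 hSd.2 rfl rfl
      constructor
      · refine mul_left_cancel₀ hS ?_
        field_simp
        linear_combination e2
      · refine mul_left_cancel₀ hS ?_
        field_simp
        linear_combination e1
  obtain ⟨lam, hlam⟩ := hrad
  obtain ⟨z1, z2⟩ := hlam.eq_zero h hN _ hx.1
  exact hR.elim (fun hc => hc z1) fun hc => hc z2

end Separation

end KerrDeSitter

theorem mainTheorem4 (L M a rneg rin rp rc : ℝ)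
    (hKdS : KerrDeSitter.IsNonExtreme L M a rneg rin rp rc) (m : ℝ) :
    -- tortoise coordinates exist and map the region between the horizons onto the real line
    (∃ u : ℝ → ℝ, KerrDeSitter.IsTortoise L M a rp rc u) ∧
    (∀ u : ℝ → ℝ, KerrDeSitter.IsTortoise L M a rp rc u →
      Set.BijOn u (Set.Ioo rp rc) Set.univ ∧
      -- the radial Dirac system on the line has no nontrivial square integrable solution
      ∀ rad : ℝ → ℝ, (∀ y : ℝ, rad y ∈ Set.Ioo rp rc ∧ u (rad y) = y) →
        ∀ (ω : ℝ) (k : ℤ) (lam : ℂ) (W : ℝ → Fin 2 → ℂ),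
          KerrDeSitter.IsDiracSystemSolution L M a m ω k lam rad W →
          KerrDeSitter.LineSquareIntegrable W → ∀ y : ℝ, W y = 0) ∧
    -- the radial system in the radius has no nontrivial square integrable solution
    (∀ (ω : ℝ) (k : ℤ) (lam : ℂ) (Rm Rp : ℝ → ℂ),
      KerrDeSitter.IsRadialSolution L M a rp rc m ω k lam Rm Rp →
      KerrDeSitter.RadialNormalizable L M a rp rc Rm Rp →
      ∀ r ∈ Set.Ioo rp rc, Rm r = 0 ∧ Rp r = 0) ∧
    -- the Dirac equation has no bound states
    ¬ ∃ Ψ : (Fin 4 → ℝ) → Fin 4 → ℂ, KerrDeSitter.IsBoundState L M a rp rc m Ψ := by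
  refine ⟨hKdS.exists_isTortoise, fun u hu => ⟨hu.bijOn hKdS, ?_⟩, ?_, ?_⟩
  · exact fun rad hrad ω k lam W hW hI y => hW.eq_zero hKdS hu hrad hI y
  · exact fun ω k lam Rm Rp hR hI => hR.eq_zero hKdS hI
  · exact fun ⟨_, hΨ⟩ => KerrDeSitter.not_isBoundState hKdS hΨ
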